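/- **Setting.** Let $(X,d)$ be a proper (closed bounded sets are compact) complete geodesic metric space, $\Omega\subset X$ a bounded open set, $f\in C(\Omega)$ with $f>0$ in $\Omega$, and $u\in C(\Omega)$. Consider the eikonal equation $|\nabla u|=f$ in $\Omega$. **Slopes.** Put $[a]_+=\max\{a,0\}$, $[a]_-=-\min\{a,0\}$ and $$|\nabla u|(x)=\limsup_{y\to x}\frac{|u(y)-u(x)|}{d(x,y)},\qquad |\nabla^{\pm}u|(x)=\limsup_{y\to x}\frac{[u(y)-u(x)]_{\pm}}{d(x,y)}.$$ $\mathrm{Lip}_{loc}(\Omega)$ is the set of locally Lipschitz functions on $\Omega$. **Monge solution.** $u\in \mathrm{Lip}_{loc}(\Omega)$ and $|\nabla^-u|=f$ in $\Omega$. **s-solution.** Let $\overline{\mathcal C}(\Omega)$ (resp. $\underline{\mathcal C}(\Omega)$) be the set of $\psi\in \mathrm{Lip}_{loc}(\Omega)$ with $|\nabla\psi|$ continuous in $\Omega$ and $|\nabla^+\psi|=|\nabla\psi|$ (resp. $|\nabla^-\psi|=|\nabla\psi|$) in $\Omega$; let $|\nabla\psi|^*(x)=\limsup_{y\to x}|\nabla\psi|(y)$.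 Then $u\in C(\Omega)$ is an s-solution if for all $\psi_2\in\mathrm{Lip}_{loc}(\Omega)$ and $x\in\Omega$: $|\nabla\psi_1|(x)\le f(x)+|\nabla\psi_2|^*(x)$ whenever $\psi_1\in\underline{\mathcal C}(\Omega)$ and $u-\psi_1-\psi_2$ has a local maximum at $x$, and $|\nabla\psi_1|(x)\ge f(x)-|\nabla\psi_2|^*(x)$ whenever $\psi_1\in\overline{\mathcal C}(\Omega)$ and $u-\psi_1-\psi_2$ has a local minimum at $x$. **c-solutions.** For $S\subset X$ let $\mathcal A_x(\mathbb R,S)$ be the set of arc-length parametrized curves $\gamma:\mathbb R\to S$ with $\gamma(0)=x$, and for $\gamma\in\mathcal A_x(\mathbb R,X)$ let $T_S^+[\gamma]=\inf\{t\ge0:\gamma(t)\notin S\}$, $T_S^-[\gamma]=\sup\{t\le0:\gamma(t)\notin S\}$ (possibly $\pm\infty$). - $u$ is a *c-subsolution* if $|\phi'(0)|\le f(x)$ for all $x\in\Omega$, $\gamma\in\mathcal A_x(\mathbb R,\Omega)$ and $\phi\in C^1(\mathbb R)$ such that $u\circ\gamma-\phi$ has a local maximum at $0$. - An *$(\varepsilon,S)$-pair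 at $x$* is a curve $\gamma\in\mathcal A_x(\mathbb R,X)$ with a lower semicontinuous $w:(T_S^-[\gamma],T_S^+[\gamma])\to\mathbb R$ such that $w(0)=u(x)$, $w\ge u\circ\gamma-\varepsilon$, and $|\phi'(t_0)|\ge f(\gamma(t_0))-\varepsilon$ whenever $\phi\in C^1(\mathbb R)$ and $w-\phi$ has a local minimum at $t_0\in(T_S^-[\gamma],T_S^+[\gamma])$. - $u$ is a *c-supersolution* if for every $\varepsilon>0$ and $x\in\Omega$ there is an $(\varepsilon,\Omega)$-pair at $x$ with $T^\pm_\Omega[\gamma]$ finite. - $u$ is a *local c-supersolution* if for every $x\in\Omega$ there is $r>0$ with $B_r(x)\subset\Omega$ such that for every $\varepsilon>0$ there is an $(\varepsilon,B_r(x))$-pair at $x$. - $u\in C(\Omega)$ is a *c-solution* (resp. *local c-solution*) if it is a c-subsolution and a c-supersolution (resp. local c-supersolution). **Theorem.** 1. The following are equivalent: $u$ is a local c-solution; $u$ is an s-solution; $u$ is a Monge solution. 2. If $u$ is a c-solution, then $u$ is a Monge solution (hence also an s-solution). 3. If $f$ is bounded in $\Omega$, the following are equivalent: (a) $u$ is a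 c-solution; (b) $u$ is an s-solution; (c) $u$ is a Monge solution. 4. If $u$ is a c-solution, a local c-solution, an s-solution or a Monge solution, then $u\in\mathrm{Lip}_{loc}(\Omega)$ and $|\nabla u|(x)=|\nabla^-u|(x)=f(x)$ for all $x\in\Omega$. -/

import Mathlib

open Set Filter Topology

noncomputable section

namespace Eikonal

variable {X : Type*} [MetricSpace X]

/-- A geodesic space: any two points are joined by a curve `γ : [a, b] → X` whose length
(the supremum of the sums over partitions) is the distance of the two points. -/
def IsGeodesicSpace (X : Type*) [MetricSpace X] : Prop :=
  ∀ x y : X, ∃ (a b : ℝ) (γ : ℝ → X), a ≤ b ∧ ContinuousOn γ (Icc a b) ∧ γ a = x ∧ γ b = y ∧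
    eVariationOn γ (Icc a b) = edist x y

/-! ### Slopes -/

/-- The local slope `|∇u|(x) = limsup_{y → x} |u(y) - u(x)| / d(x, y)`, in `[0, ∞]`. -/
def localSlope (u : X → ℝ) (x : X) : ENNReal :=
  limsup (fun y => ENNReal.ofReal (|u y - u x| / dist x y)) (𝓝[≠] x)

/-- The super-slope `|∇⁺u|(x) = limsup_{y → x} [u(y) - u(x)]₊ / d(x, y)`, in `[0, ∞]`. -/
def superSlope (u : X → ℝ) (x : X) : ENNReal :=
  limsup (fun y => ENNReal.ofReal (max (u y - u x) 0 / dist x y)) (𝓝[≠] x)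

/-- The sub-slope `|∇⁻u|(x) = limsup_{y → x} [u(y) - u(x)]₋ / d(x, y)`, in `[0, ∞]`,
with `[a]₋ = - min {a, 0}`. -/
def subSlope (u : X → ℝ) (x : X) : ENNReal :=
  limsup (fun y => ENNReal.ofReal (-min (u y - u x) 0 / dist x y)) (𝓝[≠] x)

/-! ### Monge solutions of `|∇u| = f` in `Ω`

All functions on `Ω` are given as functions on `X`, of which only the values on the open set `Ω`
matter. -/

/-- Monge solution: locally Lipschitz in `Ω` with `|∇⁻u| = f` in `Ω`. -/
def IsMongeSolution (Ω : Set X) (f u : X → ℝ) : Prop :=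
  LocallyLipschitzOn Ω u ∧ ∀ x ∈ Ω, subSlope u x = ENNReal.ofReal (f x)

/-! ### Slope-based solutions -/

/-- The class of `ψ ∈ Lip_loc(Ω)` with `|∇⁺ψ| = |∇ψ|` and `|∇ψ|` continuous in `Ω`. -/
def UpperTestClass (Ω : Set X) : Set (X → ℝ) :=
  {ψ | LocallyLipschitzOn Ω ψ ∧ (∀ x ∈ Ω, superSlope ψ x = localSlope ψ x) ∧ ContinuousOn (localSlope ψ) Ω}

/-- The class of `ψ ∈ Lip_loc(Ω)` with `|∇⁻ψ| = |∇ψ|` and `|∇ψ|` continuous in `Ω`. -/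
def LowerTestClass (Ω : Set X) : Set (X → ℝ) :=
  {ψ | LocallyLipschitzOn Ω ψ ∧ (∀ x ∈ Ω, subSlope ψ x = localSlope ψ x) ∧ ContinuousOn (localSlope ψ) Ω}

/-- The upper semicontinuous envelope `|∇ψ|^*(x) = limsup_{y → x} |∇ψ|(y)`. -/
def slopeEnvelope (ψ : X → ℝ) (x : X) : ENNReal :=
  limsup (localSlope ψ) (𝓝 x)

/-- s-subsolution: `|∇ψ₁|(x) ≤ f(x) + |∇ψ₂|^*(x)` whenever `u - ψ₁ - ψ₂` has a local maximum
at `x`. -/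
def IsSSubsolution (Ω : Set X) (f u : X → ℝ) : Prop :=
  UpperSemicontinuousOn u Ω ∧
  ∀ ψ₁ ∈ LowerTestClass Ω, ∀ ψ₂ : X → ℝ, LocallyLipschitzOn Ω ψ₂ → ∀ x ∈ Ω,
    IsLocalMax (fun y => u y - ψ₁ y - ψ₂ y) x →
      localSlope ψ₁ x ≤ ENNReal.ofReal (f x) + slopeEnvelope ψ₂ x

/-- s-supersolution: `|∇ψ₁|(x) ≥ f(x) - |∇ψ₂|^*(x)` whenever `u - ψ₁ - ψ₂` has a local minimum
at `x`. -/
def IsSSupersolution (Ω : Set X) (f u : X → ℝ) : Prop :=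
  LowerSemicontinuousOn u Ω ∧
  ∀ ψ₁ ∈ UpperTestClass Ω, ∀ ψ₂ : X → ℝ, LocallyLipschitzOn Ω ψ₂ → ∀ x ∈ Ω,
    IsLocalMin (fun y => u y - ψ₁ y - ψ₂ y) x →
      ENNReal.ofReal (f x) ≤ localSlope ψ₁ x + slopeEnvelope ψ₂ x

/-- s-solution. -/
def IsSSolution (Ω : Set X) (f u : X → ℝ) : Prop :=
  ContinuousOn u Ω ∧ IsSSubsolution Ω f u ∧ IsSSupersolution Ω f u

/-! ### Curve-based solutions -/

/-- `𝒜_x(ℝ, S)`: the arc-length parametrized curves `γ : ℝ → S` with `γ(0) = x`. -/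
def AdmissibleCurves (S : Set X) (x : X) : Set (ℝ → X) :=
  {γ | HasUnitSpeedOn γ univ ∧ (∀ t, γ t ∈ S) ∧ γ 0 = x}

/-- The exit time `T⁺_S[γ] = inf {t ≥ 0 : γ(t) ∉ S}`, in the extended reals (`inf ∅ = ∞`). -/
def exitTime (S : Set X) (γ : ℝ → X) : EReal :=
  sInf ((fun t : ℝ => (t : EReal)) '' {t | 0 ≤ t ∧ γ t ∉ S})

/-- The entrance time `T⁻_S[γ] = sup {t ≤ 0 : γ(t) ∉ S}`, in the extended reals
(`sup ∅ = -∞`). -/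
def entranceTime (S : Set X) (γ : ℝ → X) : EReal :=
  sSup ((fun t : ℝ => (t : EReal)) '' {t | t ≤ 0 ∧ γ t ∉ S})

/-- The open time interval `(T⁻_S[γ], T⁺_S[γ])`. -/
def lifeInterval (S : Set X) (γ : ℝ → X) : Set ℝ :=
  {t | entranceTime S γ < (t : EReal) ∧ (t : EReal) < exitTime S γ}

/-- `w` is a lower semicontinuous function on `(T⁻_S[γ], T⁺_S[γ])` with `w(0) = u(x)` and
`w ≥ u ∘ γ - ε`, which satisfies `|w'| ≥ f ∘ γ - ε` in the viscosity sense there. -/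
def IsApproximation (S : Set X) (f u : X → ℝ) (ε : ℝ) (x : X) (γ : ℝ → X) (w : ℝ → ℝ) : Prop :=
  LowerSemicontinuousOn w (lifeInterval S γ) ∧ w 0 = u x ∧
  (∀ t ∈ lifeInterval S γ, u (γ t) - ε ≤ w t) ∧
  ∀ φ : ℝ → ℝ, ContDiff ℝ 1 φ → ∀ t₀ ∈ lifeInterval S γ,
    IsLocalMin (fun t => w t - φ t) t₀ → f (γ t₀) - ε ≤ |deriv φ t₀|

/-- c-subsolution. -/
def IsCSubsolution (Ω : Set X) (f u : X → ℝ) : Prop :=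
  UpperSemicontinuousOn u Ω ∧
  ∀ x ∈ Ω, ∀ γ ∈ AdmissibleCurves Ω x, ∀ φ : ℝ → ℝ, ContDiff ℝ 1 φ →
    IsLocalMax (fun t => u (γ t) - φ t) 0 → |deriv φ 0| ≤ f x

/-- c-supersolution. -/
def IsCSupersolution (Ω : Set X) (f u : X → ℝ) : Prop :=
  LowerSemicontinuousOn u Ω ∧
  ∀ ε : ℝ, 0 < ε → ∀ x ∈ Ω, ∃ γ ∈ AdmissibleCurves univ x, ∃ w : ℝ → ℝ,
    ⊥ < entranceTime Ω γ ∧ exitTime Ω γ < ⊤ ∧ IsApproximation Ω f u ε x γ w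

/-- c-solution. -/
def IsCSolution (Ω : Set X) (f u : X → ℝ) : Prop :=
  ContinuousOn u Ω ∧ IsCSubsolution Ω f u ∧ IsCSupersolution Ω f u

/-- Local c-supersolution: the approximation is required only up to the exit from a ball
`B_r(x) ⊆ Ω`, with `r` independent of `ε`, and the exit need not happen in finite time. -/
def IsLocalCSupersolution (Ω : Set X) (f u : X → ℝ) : Prop :=
  LowerSemicontinuousOn u Ω ∧
  ∀ x ∈ Ω, ∃ r : ℝ, 0 < r ∧ Metric.ball x r ⊆ Ω ∧
    ∀ ε : ℝ, 0 < ε → ∃ γ ∈ AdmissibleCurves univ x, ∃ w : ℝ → ℝ,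
      IsApproximation (Metric.ball x r) f u ε x γ w

/-- Local c-solution. -/
def IsLocalCSolution (Ω : Set X) (f u : X → ℝ) : Prop :=
  ContinuousOn u Ω ∧ IsCSubsolution Ω f u ∧ IsLocalCSupersolution Ω f u

end Eikonal

end

/-!
All notions are compared with Monge solutions, through three facts about a continuous `u` on `Ω`.

*Upper bounds propagate along geodesics.* A pointwise bound `|∇⁻u| ≤ f` integrates along any
1-Lipschitz curve and, by reversing the curve, bounds the increments of `u` from both sides
(`abs_sub_le_of_subSlope_le`). As `X` is geodesic, `u` is then Lipschitz near `x` with every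
constant above `f x` (`HasLipschitzBound`), whence `|∇u| ≤ f`. The same estimate follows from the
subsolution properties: for s-subsolutions by testing with smoothed cones `h(d(z, ·))`
(`IsSSubsolution.superSlope_le`), for c-subsolutions by testing along geodesics run back and forth
(`IsCSubsolution.hasLipschitzBound`).

*Lower bounds are descents.* By compactness of closed balls, if `u + k d(x, ·)` has no interior
local minimum in a ball of radius `δ` around `x`, then `u` drops by `k δ` from `x` to some point of
the sphere (`exists_descent_of_not_isLocalMin`). Interior minima are excluded where `k < f`, both
for s-supersolutions, with `-k d(x, ·)` in the role of the Lipschitz perturbation, and for Monge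
solutions. For c-supersolutions, the approximating function `w` itself must descend in one of the
two directions of time (`descent_of_forall_isLocalMin`). In each case `|∇⁻u| ≥ f`.

*Descents concatenate to curves.* For a Monge solution with `f` bounded, steps of a fixed small
length `δ`, each following a geodesic to a point of the sphere where `u` has dropped by almost
`f δ`, reach a given neighbourhood of the complement of `Ω` after finitely many steps, because `u`
is bounded below away from the complement. From there a short geodesic leaves `Ω`; the boundedness
of `f` keeps `u` under control on it (`IsMongeSolution.exists_hasDescentCurve`). The resulting curve
`γ`, reflected in time, and `w(t) = u(x) - ∫₀^|t| (f ∘ γ - ε')` witness the c-supersolution property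
(`HasDescentCurve.exists_isApproximation`). For unbounded `f` the construction is applied to a
small ball in place of `Ω`, which gives the local property.
-/

namespace Eikonal

variable {X : Type*} [MetricSpace X]

/-! ### Slopes and pointwise estimates -/

lemma limsup_quotient_le {D : X → ℝ} {x : X} {r : ℝ} (h : ∀ᶠ y in 𝓝 x, D y ≤ r * dist x y) :
    limsup (fun y => ENNReal.ofReal (D y / dist x y)) (𝓝[≠] x) ≤ ENNReal.ofReal r := by
  refine limsup_le_of_le (by isBoundedDefault) ?_
  filter_upwards [nhdsWithin_le_nhds h, self_mem_nhdsWithin] with y hy hne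
  have hd : 0 < dist x y := dist_pos.2 (Ne.symm hne)
  exact ENNReal.ofReal_le_ofReal ((div_le_iff₀ hd).2 hy)

lemma eventually_le_of_limsup_quotient_lt {D : X → ℝ} {x : X} {r : ℝ} (hD : D x ≤ 0)
    (h : limsup (fun y => ENNReal.ofReal (D y / dist x y)) (𝓝[≠] x) < ENNReal.ofReal r) :
    ∀ᶠ y in 𝓝 x, D y ≤ r * dist x y := by
  have hr : 0 < r := ENNReal.ofReal_pos.1 (bot_le.trans_lt h)
  have h1 := eventually_lt_of_limsup_lt h
  rw [eventually_nhdsWithin_iff] at h1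
  filter_upwards [h1] with y hy
  by_cases hxy : y = x
  · subst hxy; simpa using hD
  · have hd : 0 < dist x y := dist_pos.2 (Ne.symm hxy)
    have := (ENNReal.ofReal_lt_ofReal_iff hr).1 (hy hxy)
    exact ((div_lt_iff₀ hd).1 this).le

lemma localSlope_le {u : X → ℝ} {x : X} {r : ℝ}
    (h : ∀ᶠ y in 𝓝 x, |u y - u x| ≤ r * dist x y) : localSlope u x ≤ ENNReal.ofReal r :=
  limsup_quotient_le h

lemma eventually_abs_le {u : X → ℝ} {x : X} {r : ℝ} (h : localSlope u x < ENNReal.ofReal r) :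
    ∀ᶠ y in 𝓝 x, |u y - u x| ≤ r * dist x y :=
  eventually_le_of_limsup_quotient_lt (D := fun y => |u y - u x|) (by simp) h

lemma subSlope_le {u : X → ℝ} {x : X} {r : ℝ} (hr : 0 ≤ r)
    (h : ∀ᶠ y in 𝓝 x, u x - u y ≤ r * dist x y) : subSlope u x ≤ ENNReal.ofReal r := by
  refine limsup_quotient_le ?_
  filter_upwards [h] with y hy
  have : 0 ≤ r * dist x y := by positivity
  rw [← max_neg_neg]
  exact max_le (by linarith) (by simpa using this)

lemma eventually_sub_le {u : X → ℝ} {x : X} {r : ℝ} (h : subSlope u x < ENNReal.ofReal r) :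
    ∀ᶠ y in 𝓝 x, u x - u y ≤ r * dist x y := by
  filter_upwards [eventually_le_of_limsup_quotient_lt (D := fun y => -min (u y - u x) 0)
    (by simp) h] with y hy
  have : min (u y - u x) 0 ≤ u y - u x := min_le_left _ _
  linarith

lemma subSlope_le_localSlope (u : X → ℝ) (x : X) : subSlope u x ≤ localSlope u x := by
  refine limsup_le_limsup (Eventually.of_forall fun y => ?_) (by isBoundedDefault)
    (by isBoundedDefault)
  refine ENNReal.ofReal_le_ofReal (div_le_div_of_nonneg_right ?_ dist_nonneg)
  rw [← max_neg_neg]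
  exact max_le (neg_le_abs _) (by simp)

lemma le_subSlope {u : X → ℝ} {x : X} {r : ℝ}
    (h : ∃ᶠ y in 𝓝[≠] x, r * dist x y ≤ u x - u y) : ENNReal.ofReal r ≤ subSlope u x := by
  refine le_limsup_of_frequently_le' ?_
  refine (h.and_eventually self_mem_nhdsWithin).mono ?_
  rintro y ⟨hy, hne⟩
  have hd : 0 < dist x y := dist_pos.2 (Ne.symm hne)
  refine ENNReal.ofReal_le_ofReal ((le_div_iff₀ hd).2 ?_)
  have : min (u y - u x) 0 ≤ u y - u x := min_le_left _ _
  linarith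

/-- A lower bound for the sub-slope from points of controlled descent at arbitrarily small
distance. -/
lemma le_subSlope_of_forall_exists {u : X → ℝ} {x : X} {r : ℝ} (hr : 0 < r)
    (h : ∀ δ > 0, ∃ y s, 0 < s ∧ s < δ ∧ dist x y ≤ s ∧ r * s ≤ u x - u y) :
    ENNReal.ofReal r ≤ subSlope u x := by
  refine le_subSlope ?_
  rw [Metric.nhdsWithin_basis_ball.frequently_iff]
  intro δ hδ
  obtain ⟨y, s, hs0, hs, hd, hy⟩ := h δ hδ
  refine ⟨y, ⟨by rw [Metric.mem_ball']; linarith, ?_⟩, by nlinarith⟩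
  rintro rfl
  have : 0 < r * s := by positivity
  simp at hy; linarith

lemma ofReal_le_of_forall_lt {a : ENNReal} {r : ℝ} (h : ∀ s, 0 < s → s < r → ENNReal.ofReal s ≤ a) :
    ENNReal.ofReal r ≤ a := by
  rcases le_or_gt r 0 with hr | hr
  · simp [ENNReal.ofReal_of_nonpos hr]
  have ht : Tendsto ENNReal.ofReal (𝓝[<] r) (𝓝 (ENNReal.ofReal r)) :=
    (ENNReal.continuous_ofReal.tendsto r).mono_left nhdsWithin_le_nhds
  refine le_of_tendsto ht ?_
  filter_upwards [Ioo_mem_nhdsLT hr] with s hs using h s hs.1 hs.2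

lemma le_ofReal_of_forall_gt {a : ENNReal} {r : ℝ} (h : ∀ s, r < s → a ≤ ENNReal.ofReal s) :
    a ≤ ENNReal.ofReal r := by
  have ht : Tendsto ENNReal.ofReal (𝓝[>] r) (𝓝 (ENNReal.ofReal r)) :=
    (ENNReal.continuous_ofReal.tendsto r).mono_left nhdsWithin_le_nhds
  refine ge_of_tendsto ht ?_
  filter_upwards [self_mem_nhdsWithin] with s hs using h s hs

/-- If the decrease of `v` from `x` is bounded by the oscillations of `a` and `b`, then
`|∇⁻v| ≤ |∇a| + |∇b|` at `x`. A local extremum of `u - ψ₁ - ψ₂` gives such a bound, with `v` one of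
these functions. -/
lemma subSlope_le_add {v a b : X → ℝ} {x : X}
    (h : ∀ᶠ y in 𝓝 x, v x - v y ≤ |a y - a x| + |b y - b x|) :
    subSlope v x ≤ localSlope a x + localSlope b x := by
  refine ENNReal.le_of_forall_pos_le_add fun ε hε hfin => ?_
  have hA : localSlope a x ≠ ⊤ := fun h => by simp [h] at hfin
  have hB : localSlope b x ≠ ⊤ := fun h => by simp [h] at hfin
  set A := (localSlope a x).toReal
  set B := (localSlope b x).toReal
  have hA0 : 0 ≤ A := ENNReal.toReal_nonneg
  have hB0 : 0 ≤ B := ENNReal.toReal_nonneg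
  have hε' : (0 : ℝ) < ε := hε
  have eA : localSlope a x = ENNReal.ofReal A := (ENNReal.ofReal_toReal hA).symm
  have eB : localSlope b x = ENNReal.ofReal B := (ENNReal.ofReal_toReal hB).symm
  have h1 := eventually_abs_le (u := a) (x := x) (r := A + ε / 2)
    (by rw [eA, ENNReal.ofReal_lt_ofReal_iff (by positivity)]; linarith)
  have h2 := eventually_abs_le (u := b) (x := x) (r := B + ε / 2)
    (by rw [eB, ENNReal.ofReal_lt_ofReal_iff (by positivity)]; linarith)
  have : subSlope v x ≤ ENNReal.ofReal (A + B + ε) := by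
    refine subSlope_le (by positivity) ?_
    filter_upwards [h, h1, h2] with y hy hy1 hy2
    linarith
  rwa [ENNReal.ofReal_add (by positivity) (by positivity), ENNReal.ofReal_add hA0 hB0, ← eA, ← eB,
    ENNReal.ofReal_coe_nnreal] at this

lemma localSlope_le_slopeEnvelope (ψ : X → ℝ) (x : X) : localSlope ψ x ≤ slopeEnvelope ψ x := by
  refine le_limsup_of_frequently_le' ?_
  intro h
  exact h.self_of_nhds le_rfl

/-! ### Local Lipschitz estimates -/

/-- `u` is Lipschitz near every point `x` of `Ω` with any constant above `f x`. -/
def HasLipschitzBound (Ω : Set X) (f u : X → ℝ) : Prop :=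
  ∀ x ∈ Ω, ∀ M, f x < M → ∃ ρ > 0, ∀ y ∈ Metric.ball x ρ, ∀ z ∈ Metric.ball x ρ,
    |u y - u z| ≤ M * dist y z

lemma HasLipschitzBound.localSlope_le {Ω : Set X} {f u : X → ℝ} (h : HasLipschitzBound Ω f u)
    {x : X} (hx : x ∈ Ω) : localSlope u x ≤ ENNReal.ofReal (f x) := by
  refine le_ofReal_of_forall_gt fun M hM => Eikonal.localSlope_le ?_
  obtain ⟨ρ, hρ, H⟩ := h x hx M hM
  filter_upwards [Metric.ball_mem_nhds x hρ] with y hy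
  rw [dist_comm]
  exact H y hy x (Metric.mem_ball_self hρ)

lemma HasLipschitzBound.of_neg {Ω : Set X} {f u : X → ℝ}
    (h : HasLipschitzBound Ω f fun y => -u y) : HasLipschitzBound Ω f u := fun x hx M hM => by
  obtain ⟨ρ, hρ, H⟩ := h x hx M hM
  refine ⟨ρ, hρ, fun y hy z hz => ?_⟩
  rw [abs_sub_comm, ← neg_sub_neg]
  exact H y hy z hz

lemma locallyLipschitzOn_of_ball {Ω : Set X} {u : X → ℝ}
    (h : ∀ x ∈ Ω, ∃ M : ℝ, ∃ ρ > 0, ∀ y ∈ Metric.ball x ρ, ∀ z ∈ Metric.ball x ρ,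
      |u y - u z| ≤ M * dist y z) : LocallyLipschitzOn Ω u := by
  intro x hx
  obtain ⟨M, ρ, hρ, H⟩ := h x hx
  refine ⟨M.toNNReal, Metric.ball x ρ, nhdsWithin_le_nhds (Metric.ball_mem_nhds x hρ), ?_⟩
  refine LipschitzOnWith.of_dist_le_mul fun y hy z hz => ?_
  rw [Real.dist_eq]
  exact (H y hy z hz).trans (mul_le_mul_of_nonneg_right (Real.le_coe_toNNReal M) dist_nonneg)

lemma HasLipschitzBound.locallyLipschitzOn {Ω : Set X} {f u : X → ℝ}
    (h : HasLipschitzBound Ω f u) : LocallyLipschitzOn Ω u :=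
  locallyLipschitzOn_of_ball fun x hx => ⟨f x + 1, h x hx _ (lt_add_one _)⟩

lemma locallyLipschitzOn_of_abs_sub_le {Ω : Set X} {u : X → ℝ} {M : ℝ}
    (h : ∀ y z, |u y - u z| ≤ M * dist y z) : LocallyLipschitzOn Ω u :=
  locallyLipschitzOn_of_ball fun _ _ => ⟨M, 1, one_pos, fun y _ z _ => h y z⟩

/-! ### Unit-speed curves -/

lemma hasUnitSpeedOn_of_dist_eq {σ : ℝ → X} {a b : ℝ}
    (h : ∀ s ∈ Icc a b, ∀ t ∈ Icc a b, dist (σ s) (σ t) = |s - t|) :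
    HasUnitSpeedOn σ (Icc a b) := by
  intro x hx y hy
  have key : eVariationOn σ (Icc a b ∩ Icc x y) = eVariationOn id (Icc a b ∩ Icc x y) := by
    unfold eVariationOn
    refine iSup_congr fun p => Finset.sum_congr rfl fun i _ => ?_
    rw [edist_dist, edist_dist, h _ (p.2.2.2 _).1 _ (p.2.2.2 _).1, Real.dist_eq]
    rfl
  rw [key, Icc_inter_Icc, sup_of_le_right hx.1, inf_of_le_right hy.2, eVariationOn_id_Icc]
  simp

lemma _root_.HasUnitSpeedOn.dist_le {γ : ℝ → X} {S : Set ℝ} (h : HasUnitSpeedOn γ S) {s t : ℝ}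
    (hs : s ∈ S) (ht : t ∈ S) : dist (γ s) (γ t) ≤ |s - t| := by
  wlog hst : s ≤ t generalizing s t
  · rw [dist_comm, abs_sub_comm]; exact this ht hs (le_of_not_ge hst)
  have h1 := eVariationOn.edist_le γ (s := S ∩ Icc s t) ⟨hs, left_mem_Icc.2 hst⟩
    ⟨ht, right_mem_Icc.2 hst⟩
  rw [h hs ht, edist_dist, ENNReal.ofReal_le_ofReal_iff (by simpa using hst)] at h1
  rw [abs_sub_comm, abs_of_nonneg (by linarith)]
  simpa using h1

lemma _root_.HasUnitSpeedOn.continuousOn {γ : ℝ → X} {S : Set ℝ} (h : HasUnitSpeedOn γ S) :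
    ContinuousOn γ S := by
  have : LipschitzOnWith 1 γ S := LipschitzOnWith.of_dist_le_mul fun s hs t ht => by
    simpa [Real.dist_eq] using h.dist_le hs ht
  exact this.continuousOn

lemma _root_.HasUnitSpeedOn.congr {γ γ' : ℝ → X} {S : Set ℝ} (h : HasUnitSpeedOn γ S)
    (heq : EqOn γ' γ S) : HasUnitSpeedOn γ' S := by
  intro x hx y hy
  rw [← h hx hy]
  exact eVariationOn.congr (heq.mono inter_subset_left)

lemma _root_.HasUnitSpeedOn.comp_add {γ : ℝ → X} {S : Set ℝ} (h : HasUnitSpeedOn γ S) (c : ℝ) :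
    HasUnitSpeedOn (fun t => γ (t + c)) ((fun t => t + c) ⁻¹' S) := by
  intro x hx y hy
  have h1 := eVariationOn.comp_eq_of_monotoneOn γ (t := ((fun t => t + c) ⁻¹' S) ∩ Icc x y)
    (fun t => t + c) (fun a _ b _ hab => by simpa using hab)
  have h2 : (fun t => t + c) '' (((fun t => t + c) ⁻¹' S) ∩ Icc x y) = S ∩ Icc (x + c) (y + c) := by
    rw [image_preimage_inter, image_add_const_Icc]
  rw [h2, h hx hy] at h1
  simpa [Function.comp_def] using h1

lemma _root_.HasUnitSpeedOn.comp_neg {γ : ℝ → X} {S : Set ℝ} (h : HasUnitSpeedOn γ S) :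
    HasUnitSpeedOn (fun t => γ (-t)) ((fun t => -t) ⁻¹' S) := by
  intro x hx y hy
  have h1 := eVariationOn.comp_eq_of_antitoneOn γ (t := ((fun t => -t) ⁻¹' S) ∩ Icc x y)
    (fun t => -t) (fun a _ b _ hab => by simpa using hab)
  have h2 : (fun t : ℝ => -t) '' (((fun t => -t) ⁻¹' S) ∩ Icc x y) = S ∩ Icc (-y) (-x) := by
    rw [image_preimage_inter]; simp
  rw [h2, h hy hx] at h1
  have e : -x - -y = y - x := by ring
  rw [e] at h1
  exact h1

/-- A unit-speed curve on `[0, T]` extends to an even unit-speed curve on `ℝ` with the same trace,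
running back and forth. -/
lemma _root_.HasUnitSpeedOn.exists_extension {γ : ℝ → X} {T : ℝ} (hT : 0 < T)
    (h : HasUnitSpeedOn γ (Icc 0 T)) :
    ∃ γ' : ℝ → X, HasUnitSpeedOn γ' univ ∧ (∀ t, |t| ≤ T → γ' t = γ |t|) ∧
      ∀ t, ∃ s ∈ Icc 0 T, γ' t = γ s := by
  -- the triangle wave of period `2 T` is the norm of the circle `ℝ / 2 T ℤ`
  set tri : ℝ → ℝ := fun t => ‖(t : AddCircle (2 * T))‖ with htri
  have hp : (2 * T) ≠ 0 := by positivity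
  have tri_eq : ∀ t, |t| ≤ T → tri t = |t| := fun t ht =>
    (AddCircle.norm_coe_eq_abs_iff _ hp).2 (by
      rw [abs_of_pos (by positivity : 0 < 2 * T)]; linarith)
  have tri_per : ∀ t (n : ℤ), tri (t + n * (2 * T)) = tri t := fun t n => by
    simp only [htri]
    congr 1
    rw [AddCircle.coe_add]
    have : ((n * (2 * T) : ℝ) : AddCircle (2 * T)) = 0 := by
      rw [AddCircle.coe_eq_zero_iff]; exact ⟨n, by simp⟩
    rw [this, add_zero]
  refine ⟨fun t => γ (tri t), ?_, fun t ht => by simp only [tri_eq t ht], fun t =>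
    ⟨tri t, ⟨norm_nonneg _, ?_⟩, rfl⟩⟩
  swap
  · have := AddCircle.norm_le_half_period (2 * T) (x := (t : AddCircle (2 * T))) hp
    rw [abs_of_pos (by positivity : 0 < 2 * T)] at this
    simp only [htri]; linarith
  have h1 : HasUnitSpeedOn (fun t => γ (tri t)) (Icc 0 T) := h.congr fun t ht => by
    simp only [tri_eq t (by rw [abs_of_nonneg ht.1]; exact ht.2), abs_of_nonneg ht.1]
  have h2 : HasUnitSpeedOn (fun t => γ (tri t)) (Icc (-T) 0) := by
    have := h.comp_neg
    have e : (fun t : ℝ => -t) ⁻¹' (Icc 0 T) = Icc (-T) 0 := by simp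
    rw [e] at this
    refine this.congr fun t ht => ?_
    simp only [tri_eq t (by rw [abs_of_nonpos ht.2]; linarith [ht.1]), abs_of_nonpos ht.2]
  have h3 : HasUnitSpeedOn (fun t => γ (tri t)) (Icc (-T) T) := h2.Icc_Icc h1
  have h4 : ∀ n : ℤ, HasUnitSpeedOn (fun t => γ (tri t))
      (Icc (-T + n * (2 * T)) (T + n * (2 * T))) := fun n => by
    have := HasUnitSpeedOn.comp_add h3 (((-n : ℤ) : ℝ) * (2 * T))
    simp only [tri_per] at this
    have e : (fun t : ℝ => t + ((-n : ℤ) : ℝ) * (2 * T)) ⁻¹' (Icc (-T) T) =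
        Icc (-T + n * (2 * T)) (T + n * (2 * T)) := by
      rw [preimage_add_const_Icc]; congr 1 <;> push_cast <;> ring
    rwa [e] at this
  have h5 : ∀ n : ℕ, HasUnitSpeedOn (fun t => γ (tri t))
      (Icc (-(T + n * (2 * T))) (T + n * (2 * T))) := fun n => by
    induction n with
    | zero => simpa using h3
    | succ n ih =>
      have hl := h4 (-(n + 1 : ℕ))
      have hr := h4 (n + 1 : ℕ)
      refine HasUnitSpeedOn.Icc_Icc (y := -(T + n * (2 * T))) ?_ (HasUnitSpeedOn.Icc_Icc ih ?_)
      · convert hl using 2 <;> push_cast <;> ring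
      · convert hr using 2 <;> push_cast <;> ring
  intro x _ y _
  obtain ⟨n, hn⟩ := exists_nat_ge (max |x| |y| / (2 * T))
  rw [div_le_iff₀ (by positivity)] at hn
  have hx := abs_le.1 ((le_max_left |x| |y|).trans hn)
  have hy := abs_le.1 ((le_max_right |x| |y|).trans hn)
  have hxm : x ∈ Icc (-(T + n * (2 * T))) (T + n * (2 * T)) := ⟨by linarith, by linarith⟩
  have hym : y ∈ Icc (-(T + n * (2 * T))) (T + n * (2 * T)) := ⟨by linarith, by linarith⟩
  have := h5 n hxm hym
  rw [Icc_inter_Icc, sup_of_le_right hxm.1, inf_of_le_right hym.2] at this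
  rwa [univ_inter]

/-- In a geodesic space any two points are joined by an isometric copy of an interval. -/
lemma IsGeodesicSpace.exists_geodesic (hX : IsGeodesicSpace X) (x y : X) :
    ∃ σ : ℝ → X, σ 0 = x ∧ σ (dist x y) = y ∧
      ∀ s ∈ Icc 0 (dist x y), ∀ t ∈ Icc 0 (dist x y), dist (σ s) (σ t) = |s - t| := by
  obtain ⟨a, b, γ, hab, hc, rfl, rfl, hvar⟩ := hX x y
  -- along a curve of minimal length, the distance is additive
  have hadd : ∀ s ∈ Icc a b, ∀ t ∈ Icc a b, s ≤ t →
      dist (γ a) (γ t) = dist (γ a) (γ s) + dist (γ s) (γ t) := by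
    intro s hs t ht hst
    refine le_antisymm (dist_triangle _ _ _) ?_
    have e1 := eVariationOn.Icc_add_Icc γ (s := univ) hs.1 hst (mem_univ _)
    have e2 := eVariationOn.Icc_add_Icc γ (s := univ) ht.1 ht.2 (mem_univ _)
    simp only [univ_inter] at e1 e2
    have i1 := eVariationOn.edist_le γ (left_mem_Icc.2 hs.1) (right_mem_Icc.2 hs.1)
    have i2 := eVariationOn.edist_le γ (left_mem_Icc.2 hst) (right_mem_Icc.2 hst)
    have i3 := eVariationOn.edist_le γ (left_mem_Icc.2 ht.2) (right_mem_Icc.2 ht.2)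
    have : edist (γ a) (γ s) + edist (γ s) (γ t) + edist (γ t) (γ b) ≤ edist (γ a) (γ b) := by
      rw [← hvar, ← e2, ← e1]; gcongr
    rw [edist_dist, edist_dist, edist_dist, edist_dist, ← ENNReal.ofReal_add (by positivity)
      (by positivity), ← ENNReal.ofReal_add (by positivity) (by positivity),
      ENNReal.ofReal_le_ofReal_iff (by positivity)] at this
    have := dist_triangle (γ a) (γ t) (γ b)
    linarith
  have hsub : ∀ s ∈ Icc a b, ∀ t ∈ Icc a b,
      dist (γ s) (γ t) = |dist (γ a) (γ s) - dist (γ a) (γ t)| := by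
    intro s hs t ht
    rcases le_total s t with hst | hst
    · rw [hadd s hs t ht hst, sub_add_cancel_left, abs_neg, abs_of_nonneg dist_nonneg]
    · rw [hadd t ht s hs hst, add_sub_cancel_left, abs_of_nonneg dist_nonneg, dist_comm]
  have hD : ContinuousOn (fun t => dist (γ a) (γ t)) (Icc a b) := by fun_prop
  have hex : ∀ s : ℝ, ∃ t, s ∈ Icc 0 (dist (γ a) (γ b)) → t ∈ Icc a b ∧ dist (γ a) (γ t) = s := by
    intro s
    by_cases hs : s ∈ Icc 0 (dist (γ a) (γ b))
    · have := intermediate_value_Icc hab hD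
      simp only [dist_self] at this
      obtain ⟨t, ht, hts⟩ := this hs
      exact ⟨t, fun _ => ⟨ht, hts⟩⟩
    · exact ⟨0, fun h => absurd h hs⟩
  choose τ hτ using hex
  have h0 := hτ 0 ⟨le_rfl, dist_nonneg⟩
  have h1 := hτ (dist (γ a) (γ b)) ⟨dist_nonneg, le_rfl⟩
  refine ⟨fun s => γ (τ s), (dist_eq_zero.1 h0.2).symm, ?_, fun s hs t ht => ?_⟩
  · refine dist_eq_zero.1 ?_
    rw [hsub _ h1.1 b (right_mem_Icc.2 hab), h1.2, sub_self, abs_zero]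
  · rw [hsub _ (hτ s hs).1 _ (hτ t ht).1, (hτ s hs).2, (hτ t ht).2]

/-! ### Sub-slopes along curves -/

/-- A bound on the sub-slope bounds the total decrease along a 1-Lipschitz curve. -/
lemma sub_le_of_subSlope_le {Ω : Set X} {u : X → ℝ} (hu : ContinuousOn u Ω) {γ : ℝ → X}
    {a b M : ℝ} (hab : a ≤ b) (hM : 0 ≤ M)
    (hγ : ∀ s ∈ Icc a b, ∀ t ∈ Icc a b, dist (γ s) (γ t) ≤ |s - t|)
    (hmem : ∀ t ∈ Icc a b, γ t ∈ Ω)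
    (hslope : ∀ t ∈ Icc a b, subSlope u (γ t) ≤ ENNReal.ofReal M) :
    u (γ a) - u (γ b) ≤ M * (b - a) := by
  have hcγ : ContinuousOn γ (Icc a b) :=
    (LipschitzOnWith.of_dist_le_mul (K := 1) fun s hs t ht => by
      simpa [Real.dist_eq] using hγ s hs t ht).continuousOn
  have hc : ContinuousOn (fun t => -u (γ t)) (Icc a b) := (hu.comp hcγ hmem).neg
  have := image_le_of_liminf_slope_right_le_deriv_boundary (f := fun t => -u (γ t)) hc
    (B := fun t => -u (γ a) + M * (t - a)) (B' := fun _ => M) (by simp) (by fun_prop)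
    (fun x _ => by
      have : HasDerivAt (fun t : ℝ => -u (γ a) + M * (t - a)) (M * 1) x :=
        (((hasDerivAt_id x).sub_const a).const_mul M).const_add _
      simpa using this.hasDerivWithinAt) ?_ (right_mem_Icc.2 hab)
  · linarith
  intro t ht r hr
  have htI : t ∈ Icc a b := Ico_subset_Icc_self ht
  obtain ⟨r', hr', hrr'⟩ := exists_between hr
  have h1 : ∀ᶠ y in 𝓝 (γ t), u (γ t) - u y ≤ r' * dist (γ t) y :=
    eventually_sub_le ((hslope t htI).trans_lt
      ((ENNReal.ofReal_lt_ofReal_iff (hM.trans_lt hr')).2 hr'))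
  have htend : Tendsto γ (𝓝[>] t) (𝓝 (γ t)) := by
    refine (hcγ t htI).mono_left ?_
    rw [← nhdsWithin_Ioo_eq_nhdsGT ht.2]
    exact nhdsWithin_mono _ fun s hs => ⟨ht.1.trans hs.1.le, hs.2.le⟩
  refine Eventually.frequently ?_
  filter_upwards [htend.eventually h1, Ioo_mem_nhdsGT ht.2] with s hs hsI
  have hpos : 0 < s - t := sub_pos.2 hsI.1
  have hd := hγ t htI s ⟨ht.1.trans hsI.1.le, hsI.2.le⟩
  rw [abs_sub_comm, abs_of_pos hpos] at hd
  rw [slope_def_field, div_lt_iff₀ hpos]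
  nlinarith

lemma abs_sub_le_of_subSlope_le {Ω : Set X} {u : X → ℝ} (hu : ContinuousOn u Ω) {γ : ℝ → X}
    {a b M : ℝ} (hab : a ≤ b) (hM : 0 ≤ M)
    (hγ : ∀ s ∈ Icc a b, ∀ t ∈ Icc a b, dist (γ s) (γ t) ≤ |s - t|)
    (hmem : ∀ t ∈ Icc a b, γ t ∈ Ω)
    (hslope : ∀ t ∈ Icc a b, subSlope u (γ t) ≤ ENNReal.ofReal M) :
    |u (γ b) - u (γ a)| ≤ M * (b - a) := by
  have hneg : ∀ t ∈ Icc (-b) (-a), -t ∈ Icc a b := fun t ht =>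
    ⟨by linarith [ht.2], by linarith [ht.1]⟩
  have h1 := sub_le_of_subSlope_le hu hab hM hγ hmem hslope
  have h2 := sub_le_of_subSlope_le hu (γ := fun t => γ (-t)) (neg_le_neg hab) hM
    (fun s hs t ht => by
      have := hγ _ (hneg s hs) _ (hneg t ht)
      rwa [neg_sub_neg, abs_sub_comm] at this)
    (fun t ht => hmem _ (hneg t ht)) (fun t ht => hslope _ (hneg t ht))
  simp only [neg_neg] at h2
  exact abs_le.2 ⟨by linarith, by linarith⟩

/-- Points near `x` are joined by geodesics that stay near `x`. -/
lemma IsGeodesicSpace.exists_geodesic_in_ball (hX : IsGeodesicSpace X) {x y z : X} {ρ : ℝ}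
    (hy : y ∈ Metric.ball x ρ) (hz : z ∈ Metric.ball x ρ) :
    ∃ σ : ℝ → X, σ 0 = y ∧ σ (dist y z) = z ∧
      (∀ s ∈ Icc 0 (dist y z), ∀ t ∈ Icc 0 (dist y z), dist (σ s) (σ t) = |s - t|) ∧
      ∀ t ∈ Icc 0 (dist y z), σ t ∈ Metric.ball x (3 * ρ) := by
  obtain ⟨σ, h0, h1, hσ⟩ := hX.exists_geodesic y z
  refine ⟨σ, h0, h1, hσ, fun t ht => ?_⟩
  have h2 := hσ 0 (left_mem_Icc.2 dist_nonneg) t ht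
  rw [h0, zero_sub, abs_neg, abs_of_nonneg ht.1] at h2
  rw [Metric.mem_ball] at *
  have h3 := dist_triangle (σ t) y x
  have h4 := dist_triangle_right y z x
  rw [dist_comm (σ t) y] at h3
  linarith [ht.2]

lemma exists_ball_subset_lt {Ω : Set X} (hΩ : IsOpen Ω) {f : X → ℝ} (hf : ContinuousOn f Ω)
    {x : X} (hx : x ∈ Ω) {M : ℝ} (hM : f x < M) :
    ∃ ρ > 0, Metric.ball x ρ ⊆ Ω ∧ ∀ y ∈ Metric.ball x ρ, f y < M := by
  have h1 : ∀ᶠ y in 𝓝 x, y ∈ Ω ∧ f y < M :=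
    Filter.Eventually.and (hΩ.mem_nhds hx)
      ((hf.continuousAt (hΩ.mem_nhds hx)).eventually_lt continuousAt_const hM)
  obtain ⟨ρ, hρ, H⟩ := Metric.eventually_nhds_iff_ball.1 h1
  exact ⟨ρ, hρ, fun y hy => (H y hy).1, fun y hy => (H y hy).2⟩

lemma hasLipschitzBound_of_subSlope_le (hX : IsGeodesicSpace X) {Ω : Set X} (hΩ : IsOpen Ω)
    {f u : X → ℝ} (hf : ContinuousOn f Ω) (hfpos : ∀ x ∈ Ω, 0 < f x) (hu : ContinuousOn u Ω)
    (h : ∀ x ∈ Ω, subSlope u x ≤ ENNReal.ofReal (f x)) : HasLipschitzBound Ω f u := by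
  intro x hx M hM
  obtain ⟨ρ, hρ, hsub, hfM⟩ := exists_ball_subset_lt hΩ hf hx hM
  refine ⟨ρ / 3, by positivity, fun y hy z hz => ?_⟩
  obtain ⟨σ, h0, h1, hσ, hmem⟩ := hX.exists_geodesic_in_ball hy hz
  have e : 3 * (ρ / 3) = ρ := by ring
  rw [e] at hmem
  have := abs_sub_le_of_subSlope_le hu (γ := σ) dist_nonneg ((hfpos x hx).trans hM).le
    (fun s hs t ht => (hσ s hs t ht).le) (fun t ht => hsub (hmem t ht))
    (fun t ht => (h _ (hsub (hmem t ht))).trans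
      (ENNReal.ofReal_le_ofReal (hfM _ (hmem t ht)).le))
  rwa [h0, h1, sub_zero, abs_sub_comm] at this

/-! ### Descent to a sphere -/

/-- If the perturbation `u + k d(x, ·)` has no local minimum in the open ball, then its minimum
over the closed ball is attained on the sphere, so that `u` descends at rate `k` from `x` to some
point of the sphere. -/
lemma exists_descent_of_not_isLocalMin [ProperSpace X] {u : X → ℝ} {x : X} {δ k : ℝ} (hδ : 0 < δ)
    (hu : ContinuousOn u (Metric.closedBall x δ))
    (h : ∀ y ∈ Metric.ball x δ, ¬ IsLocalMin (fun z => u z + k * dist x z) y) :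
    ∃ y, dist x y = δ ∧ u y + k * δ ≤ u x := by
  obtain ⟨y, hy, hmin⟩ := (isCompact_closedBall x δ).exists_isMinOn
    ⟨x, Metric.mem_closedBall_self hδ.le⟩
    (f := fun z => u z + k * dist x z) (by fun_prop)
  have hyδ : dist x y = δ := by
    by_contra hne
    have hlt : y ∈ Metric.ball x δ := by
      rw [Metric.mem_closedBall'] at hy
      exact Metric.mem_ball'.2 (lt_of_le_of_ne hy hne)
    refine h y hlt ?_
    filter_upwards [Metric.isOpen_ball.mem_nhds hlt] with z hz
    exact hmin (Metric.ball_subset_closedBall hz)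
  refine ⟨y, hyδ, ?_⟩
  have := hmin (Metric.mem_closedBall_self hδ.le)
  simpa [hyδ] using this

lemma subSlope_le_of_isLocalMin {u : X → ℝ} {x y : X} {k : ℝ} (hk : 0 ≤ k)
    (h : IsLocalMin (fun z => u z + k * dist x z) y) : subSlope u y ≤ ENNReal.ofReal k := by
  refine subSlope_le hk ?_
  filter_upwards [h] with z hz
  have := dist_triangle x y z
  nlinarith

lemma IsMongeSolution.exists_descent [ProperSpace X] {Ω : Set X} {f u : X → ℝ}
    (hu : IsMongeSolution Ω f u) (huc : ContinuousOn u Ω) {x : X} {δ k : ℝ} (hδ : 0 < δ)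
    (hk : 0 ≤ k) (hsub : Metric.closedBall x δ ⊆ Ω) (hkf : ∀ y ∈ Metric.ball x δ, k < f y) :
    ∃ y, dist x y = δ ∧ u y + k * δ ≤ u x := by
  refine exists_descent_of_not_isLocalMin hδ (huc.mono hsub) fun y hy hmin => ?_
  have h1 := subSlope_le_of_isLocalMin hk hmin
  rw [hu.2 y (hsub (Metric.ball_subset_closedBall hy)), ENNReal.ofReal_le_ofReal_iff hk] at h1
  exact (hkf y hy).not_ge h1

/-! ### Slope-based solutions versus Monge solutions -/

lemma superSlope_eq_subSlope_neg (u : X → ℝ) (x : X) :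
    superSlope u x = subSlope (fun y => -u y) x := by
  unfold superSlope subSlope
  congr 1
  ext y
  rw [← max_neg_neg]
  congr 2
  simp [neg_add_eq_sub]

lemma localSlope_const (c : ℝ) (x : X) : localSlope (fun _ => c) x = 0 := by
  have := localSlope_le (u := fun _ => c) (x := x) (r := 0) (by simp)
  simpa using this

lemma zero_mem_upperTestClass (Ω : Set X) : (fun _ => (0 : ℝ)) ∈ UpperTestClass Ω := by
  refine ⟨(LipschitzWith.const (0 : ℝ)).locallyLipschitz.locallyLipschitzOn, fun x _ => ?_, ?_⟩
  · rw [localSlope_const, superSlope_eq_subSlope_neg]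
    exact le_antisymm ((subSlope_le_localSlope _ _).trans (by simp [localSlope_const])) zero_le
  · simp only [funext (localSlope_const (X := X) 0)]
    exact continuousOn_const

lemma abs_mul_dist_sub_le (k : ℝ) (x y z : X) :
    |k * dist x y - k * dist x z| ≤ |k| * dist y z := by
  rw [← mul_sub, abs_mul]
  refine mul_le_mul_of_nonneg_left ?_ (abs_nonneg _)
  rw [dist_comm x y, dist_comm x z]
  exact abs_dist_sub_le _ _ _

/-- An s-supersolution satisfies `|∇⁻u| ≥ f`: the cone `-k d(x, ·)` is admissible as the Lipschitz
perturbation `ψ₂` (with `ψ₁ = 0`), hence `u + k d(x, ·)` has no local minimum where `k < f`. -/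
lemma IsSSupersolution.le_subSlope [ProperSpace X] {Ω : Set X} (hΩ : IsOpen Ω) {f u : X → ℝ}
    (hf : ContinuousOn f Ω) (hu : ContinuousOn u Ω) (h : IsSSupersolution Ω f u) {x : X}
    (hx : x ∈ Ω) : ENNReal.ofReal (f x) ≤ subSlope u x := by
  refine ofReal_le_of_forall_lt fun k hk hkf => le_subSlope_of_forall_exists hk fun δ hδ => ?_
  obtain ⟨ρ, hρ, hsub, hlt⟩ := exists_ball_subset_lt hΩ (f := fun y => -f y) hf.neg hx
    (neg_lt_neg hkf)
  set s := min δ ρ / 2 with hs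
  have hmin : 0 < min δ ρ := lt_min hδ hρ
  have hs0 : 0 < s := by positivity
  have hsδ : s < δ := by have := min_le_left δ ρ; linarith
  have hsρ : s < ρ := by have := min_le_right δ ρ; linarith
  have hcb : Metric.closedBall x s ⊆ Metric.ball x ρ := Metric.closedBall_subset_ball hsρ
  obtain ⟨y, hy, hyk⟩ := exists_descent_of_not_isLocalMin (k := k) hs0
    (hu.mono (hcb.trans hsub)) (fun y hy hloc => by
      have hyρ := hcb (Metric.ball_subset_closedBall hy)
      have hslope : ∀ z, localSlope (fun w => -k * dist x w) z ≤ ENNReal.ofReal k := fun z =>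
        localSlope_le (Eventually.of_forall fun w => by
          have := abs_mul_dist_sub_le (-k) x w z
          rwa [abs_neg, abs_of_pos hk, dist_comm w z] at this)
      have h1 := h.2 _ (zero_mem_upperTestClass Ω) (fun w => -k * dist x w)
        (locallyLipschitzOn_of_abs_sub_le (abs_mul_dist_sub_le (-k) x)) y (hsub hyρ)
        (by simpa using hloc)
      have h2 : slopeEnvelope (fun w => -k * dist x w) y ≤ ENNReal.ofReal k :=
        limsup_le_of_le (by isBoundedDefault) (Eventually.of_forall hslope)
      rw [localSlope_const, zero_add] at h1
      have := (ENNReal.ofReal_le_ofReal_iff hk.le).1 (h1.trans h2)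
      linarith [hlt y hyρ])
  exact ⟨y, s, hs0, hsδ, hy.le, by linarith⟩

/-- Composing the distance to `z` with an increasing `C¹` function of vanishing derivative at `0`
gives a test function whose slope is the derivative. -/
lemma comp_dist_mem_lowerTestClass (hX : IsGeodesicSpace X) (Ω : Set X) (z : X) {h h' : ℝ → ℝ}
    (hd : ∀ s, HasDerivAt h (h' s) s) (hc : Continuous h') (h0 : h' 0 = 0)
    (hnn : ∀ s, 0 ≤ s → 0 ≤ h' s) :
    (fun y => h (dist z y)) ∈ LowerTestClass Ω ∧
      ∀ y, localSlope (fun y => h (dist z y)) y = ENNReal.ofReal (h' (dist z y)) := by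
  have hle : ∀ y, localSlope (fun y => h (dist z y)) y ≤ ENNReal.ofReal (h' (dist z y)) := by
    intro y
    refine le_ofReal_of_forall_gt fun r hr => localSlope_le ?_
    have hr0 : 0 < r := (hnn _ dist_nonneg).trans_lt hr
    have h1 := (hd (dist z y)).isLittleO.bound (sub_pos.2 hr)
    have h2 : Tendsto (fun w => dist z w) (𝓝 y) (𝓝 (dist z y)) :=
      (continuous_const.dist continuous_id).tendsto y
    filter_upwards [h2.eventually h1] with w hw
    simp only [Real.norm_eq_abs, smul_eq_mul] at hw
    have h3 : |dist z w - dist z y| ≤ dist y w := by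
      rw [dist_comm z w, dist_comm z y, dist_comm y w]; exact abs_dist_sub_le _ _ _
    have h4 := abs_sub_abs_le_abs_sub (h (dist z w) - h (dist z y))
      ((dist z w - dist z y) * h' (dist z y))
    rw [abs_mul, abs_of_nonneg (hnn _ dist_nonneg)] at h4
    nlinarith
  have hge : ∀ y, ENNReal.ofReal (h' (dist z y)) ≤ subSlope (fun y => h (dist z y)) y := by
    intro y
    refine ofReal_le_of_forall_lt fun r hr hrh => le_subSlope_of_forall_exists hr fun δ hδ => ?_
    have hzy : 0 < dist y z := by
      rw [dist_pos]; rintro rfl; rw [dist_self, h0] at hrh; linarith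
    obtain ⟨σ, hσ0, hσ1, hσ⟩ := hX.exists_geodesic y z
    have h1 := (hd (dist z y)).isLittleO.bound (sub_pos.2 hrh)
    obtain ⟨η, hη, H⟩ := Metric.eventually_nhds_iff_ball.1 h1
    set s := min (min δ η) (dist y z) / 2 with hs
    have hm : 0 < min (min δ η) (dist y z) := lt_min (lt_min hδ hη) hzy
    have e1 := min_le_left (min δ η) (dist y z)
    have e2 := min_le_right (min δ η) (dist y z)
    have e3 := min_le_left δ η
    have e4 := min_le_right δ η
    have hs0 : 0 < s := by positivity
    have hsI : s ∈ Icc 0 (dist y z) := ⟨hs0.le, by linarith⟩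
    have hd1 := hσ 0 (left_mem_Icc.2 dist_nonneg) s hsI
    rw [hσ0, zero_sub, abs_neg, abs_of_pos hs0] at hd1
    have hd2 := hσ (dist y z) (right_mem_Icc.2 dist_nonneg) s hsI
    rw [hσ1, abs_of_nonneg (by linarith [hsI.2]), dist_comm y z] at hd2
    refine ⟨σ s, s, hs0, by linarith, hd1.le, ?_⟩
    have hw := H (dist z (σ s)) (by
      rw [Metric.mem_ball, Real.dist_eq, hd2, sub_sub_cancel_left, abs_neg, abs_of_pos hs0]
      linarith)
    simp only [Real.norm_eq_abs, smul_eq_mul] at hw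
    rw [hd2, sub_sub_cancel_left, abs_neg, abs_of_pos hs0] at hw
    have := (abs_le.1 hw).2
    change r * s ≤ h (dist z y) - h (dist z (σ s))
    rw [hd2]
    linarith
  have heq : ∀ y, localSlope (fun y => h (dist z y)) y = ENNReal.ofReal (h' (dist z y)) := fun y =>
    le_antisymm (hle y) ((hge y).trans (subSlope_le_localSlope _ _))
  refine ⟨⟨?_, fun y _ => ?_, ?_⟩, heq⟩
  · have hC : ContDiff ℝ 1 h := contDiff_one_iff_deriv.2
      ⟨fun s => (hd s).differentiableAt, by rwa [funext fun s => (hd s).deriv]⟩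
    exact (hC.locallyLipschitz.comp
      (LipschitzWith.dist_right z).locallyLipschitz).locallyLipschitzOn
  · exact le_antisymm (subSlope_le_localSlope _ _) ((hle y).trans (hge y))
  · rw [funext heq]
    exact (ENNReal.continuous_ofReal.comp
      (hc.comp (continuous_const.dist continuous_id))).continuousOn

lemma hasDerivAt_sqrt_sq_add_sq {σ : ℝ} (hσ : 0 < σ) (s : ℝ) :
    HasDerivAt (fun s => √(s ^ 2 + σ ^ 2)) (s / √(s ^ 2 + σ ^ 2)) s := by
  have h := ((hasDerivAt_pow 2 s).add_const (σ ^ 2)).sqrt (by positivity)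
  convert h using 1
  push_cast
  field_simp

/-- An s-subsolution satisfies `|∇⁺u| ≤ f`. The test functions are
`k (√(d² + σ²) - σ) + B d²` with `d = d(z, ·)`: by the subsolution property, maxima of the
difference can only occur within distance `O(σ)` of `z`. -/
lemma IsSSubsolution.superSlope_le [ProperSpace X] (hX : IsGeodesicSpace X) {Ω : Set X}
    (hΩ : IsOpen Ω) {f u : X → ℝ} (hf : ContinuousOn f Ω) (hfpos : ∀ x ∈ Ω, 0 < f x)
    (hu : ContinuousOn u Ω) (h : IsSSubsolution Ω f u) {z : X} (hz : z ∈ Ω) :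
    superSlope u z ≤ ENNReal.ofReal (f z) := by
  rw [superSlope_eq_subSlope_neg]
  refine le_ofReal_of_forall_gt fun k' hk' => ?_
  obtain ⟨k, hk, hkk'⟩ := exists_between hk'
  obtain ⟨M, hM, hMk⟩ := exists_between hk
  have hM0 : 0 < M := (hfpos z hz).trans hM
  have hk0 : 0 < k := hM0.trans hMk
  obtain ⟨ρ, hρ, hsub, hlt⟩ := exists_ball_subset_lt hΩ hf hz hM
  set R := ρ / 2 with hR
  have hR0 : 0 < R := by positivity
  have hcb : Metric.closedBall z R ⊆ Metric.ball z ρ := Metric.closedBall_subset_ball (by linarith)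
  have huR : ContinuousOn u (Metric.closedBall z R) := hu.mono (hcb.trans hsub)
  obtain ⟨C, hC⟩ := (isCompact_closedBall z R).exists_bound_of_continuousOn huR
  set A := 2 * C with hA
  have hAu : ∀ y ∈ Metric.closedBall z R, u y - u z ≤ A := fun y hy => by
    have h1 := (abs_le.1 (hC y hy)).2
    have h2 := (abs_le.1 (hC z (Metric.mem_closedBall_self hR0.le))).1
    linarith
  have hA0 : 0 ≤ A := by simpa using hAu z (Metric.mem_closedBall_self hR0.le)
  -- the quadratic term keeps the maximum away from the sphere of radius `R`
  set B := (A + 1) / R ^ 2 with hB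
  have hB0 : 0 < B := by positivity
  have hBR : B * R ^ 2 = A + 1 := by rw [hB]; field_simp
  -- the outcome of the test with parameter `σ → 0`
  have key : ∀ y ∈ Metric.closedBall z R, u y ≤ u z + k * dist z y + B * dist z y ^ 2 := by
    intro y hy
    refine le_of_forall_pos_le_add fun ε hε => ?_
    have hcz : ContinuousAt u z := hu.continuousAt (hΩ.mem_nhds hz)
    obtain ⟨τ, hτ, Hτ⟩ := Metric.continuousAt_iff.1 hcz (ε / 2) (by positivity)
    -- `σ` so small that the critical distance is below `τ`
    obtain ⟨σ, hσ, hσk, hσM⟩ : ∃ σ > 0, k * σ < ε / 2 ∧ M * σ < (k - M) * τ := by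
      have hp : 0 < min (ε / 2 / k) ((k - M) * τ / M) :=
        lt_min (by positivity) (div_pos (mul_pos (by linarith) hτ) hM0)
      obtain ⟨σ, h0, h1⟩ := exists_between hp
      refine ⟨σ, h0, ?_, ?_⟩
      · have := (lt_div_iff₀ hk0).1 (h1.trans_le (min_le_left _ _)); linarith
      · have := (lt_div_iff₀ hM0).1 (h1.trans_le (min_le_right _ _)); linarith
    set g : ℝ → ℝ := fun s => k * (√(s ^ 2 + σ ^ 2) - σ) + B * s ^ 2 with hg
    set g' : ℝ → ℝ := fun s => k * (s / √(s ^ 2 + σ ^ 2)) + B * (2 * s) with hg'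
    have hgd : ∀ s, HasDerivAt g (g' s) s := fun s => by
      have h1 := (((hasDerivAt_sqrt_sq_add_sq hσ s).sub_const σ).const_mul k).add
        ((hasDerivAt_pow 2 s).const_mul B)
      exact h1.congr_deriv (by simp [hg'])
    have hgc : Continuous g' := by
      have : ∀ s : ℝ, √(s ^ 2 + σ ^ 2) ≠ 0 := fun s => by positivity
      fun_prop (disch := exact this _)
    obtain ⟨hmem, hslope⟩ := comp_dist_mem_lowerTestClass hX Ω z hgd hgc (by simp [hg'])
      (fun s hs => by simp only [hg']; positivity)
    have hg0 : g 0 = 0 := by simp [hg, Real.sqrt_sq hσ.le]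
    have hgnn : ∀ s, B * s ^ 2 ≤ g s := fun s => by
      have : σ ≤ √(s ^ 2 + σ ^ 2) := Real.le_sqrt_of_sq_le (by nlinarith)
      simp only [hg]; nlinarith
    have hgle : ∀ s, 0 ≤ s → g s ≤ k * s + B * s ^ 2 := fun s hs => by
      have : √(s ^ 2 + σ ^ 2) ≤ s + σ := Real.sqrt_le_iff.2 ⟨by positivity, by nlinarith⟩
      simp only [hg]; nlinarith
    have hgcont : Continuous g := continuous_iff_continuousAt.2 fun s => (hgd s).continuousAt
    obtain ⟨m, hm, hmax⟩ := (isCompact_closedBall z R).exists_isMaxOn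
      ⟨z, Metric.mem_closedBall_self hR0.le⟩ (f := fun w => u w - g (dist z w))
      (huR.sub (hgcont.comp (continuous_const.dist continuous_id)).continuousOn)
    have hmz : u z ≤ u m - g (dist z m) := by
      simpa [hg0] using hmax (Metric.mem_closedBall_self hR0.le)
    have hmR : m ∈ Metric.ball z R := by
      rw [Metric.mem_closedBall'] at hm
      refine Metric.mem_ball'.2 (lt_of_le_of_ne hm fun he => ?_)
      have h1 := hAu m (Metric.mem_closedBall'.2 hm)
      have h2 := hgnn (dist z m)
      rw [he, hBR] at h2
      rw [he] at hmz
      linarith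
    have hloc : IsLocalMax (fun w => u w - g (dist z w) - 0) m := by
      filter_upwards [Metric.isOpen_ball.mem_nhds hmR] with w hw
      have := hmax (Metric.ball_subset_closedBall hw)
      simpa using this
    have hmρ := hcb (Metric.ball_subset_closedBall hmR)
    have h1 := h.2 _ hmem (fun _ => 0)
      (LipschitzWith.const (0 : ℝ)).locallyLipschitz.locallyLipschitzOn m (hsub hmρ) hloc
    have henv : slopeEnvelope (fun _ : X => (0 : ℝ)) m = 0 := by
      unfold slopeEnvelope
      rw [funext (localSlope_const (X := X) 0)]
      exact le_antisymm (limsup_le_of_le (by isBoundedDefault)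
        (Eventually.of_forall fun _ => le_rfl)) zero_le
    rw [hslope, henv, add_zero, ENNReal.ofReal_le_ofReal_iff (hfpos m (hsub hmρ)).le] at h1
    have hmτ : dist z m < τ := by
      have hd0 : 0 ≤ dist z m := dist_nonneg
      set s := dist z m
      have hq : 0 < √(s ^ 2 + σ ^ 2) := by positivity
      have hsq : √(s ^ 2 + σ ^ 2) ≤ s + σ := Real.sqrt_le_iff.2 ⟨by positivity, by nlinarith⟩
      have h2 : k * (s / √(s ^ 2 + σ ^ 2)) ≤ M := by
        have : 0 ≤ B * (2 * s) := by positivity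
        have h3 := hlt m hmρ
        simp only [hg'] at h1
        linarith
      rw [← mul_div_assoc, div_le_iff₀ hq] at h2
      have h4 : (k - M) * s ≤ M * σ := by nlinarith
      exact lt_of_mul_lt_mul_left (h4.trans_lt hσM) (by linarith)
    have hum := Hτ (x := m) (by rwa [dist_comm])
    rw [Real.dist_eq] at hum
    have hum' := (abs_lt.1 hum).2
    have hy1 : u y - g (dist z y) ≤ u m - g (dist z m) := hmax hy
    have h5 := hgnn (dist z m)
    have h6 : 0 ≤ B * dist z m ^ 2 := by positivity
    have h7 := hgle (dist z y) dist_nonneg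
    linarith
  refine subSlope_le (hk0.trans hkk').le ?_
  have hr0 : 0 < min R ((k' - k) / B) := lt_min hR0 (div_pos (by linarith) hB0)
  filter_upwards [Metric.ball_mem_nhds z hr0] with y hy
  rw [Metric.mem_ball'] at hy
  have h1 := key y (Metric.mem_closedBall'.2 (hy.trans_le (min_le_left _ _)).le)
  have h2 := (lt_div_iff₀ hB0).1 (hy.trans_le (min_le_right _ _))
  have h3 : (0 : ℝ) ≤ dist z y := dist_nonneg
  nlinarith

lemma IsSSolution.isMongeSolution [ProperSpace X] (hX : IsGeodesicSpace X) {Ω : Set X}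
    (hΩ : IsOpen Ω) {f u : X → ℝ} (hf : ContinuousOn f Ω) (hfpos : ∀ x ∈ Ω, 0 < f x)
    (h : IsSSolution Ω f u) : IsMongeSolution Ω f u := by
  obtain ⟨hu, hsub, hsup⟩ := h
  have hL : HasLipschitzBound Ω f u :=
    (hasLipschitzBound_of_subSlope_le hX hΩ hf hfpos hu.neg fun x hx =>
      (superSlope_eq_subSlope_neg u x).symm.trans_le
        (hsub.superSlope_le hX hΩ hf hfpos hu hx)).of_neg
  exact ⟨hL.locallyLipschitzOn, fun x hx => le_antisymm
    ((subSlope_le_localSlope u x).trans (hL.localSlope_le hx)) (hsup.le_subSlope hΩ hf hu hx)⟩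

lemma IsMongeSolution.hasLipschitzBound (hX : IsGeodesicSpace X) {Ω : Set X} (hΩ : IsOpen Ω)
    {f u : X → ℝ} (hf : ContinuousOn f Ω) (hfpos : ∀ x ∈ Ω, 0 < f x)
    (h : IsMongeSolution Ω f u) : HasLipschitzBound Ω f u :=
  hasLipschitzBound_of_subSlope_le hX hΩ hf hfpos h.1.continuousOn fun x hx => (h.2 x hx).le

lemma IsMongeSolution.isSSolution (hX : IsGeodesicSpace X) {Ω : Set X} (hΩ : IsOpen Ω)
    {f u : X → ℝ} (hf : ContinuousOn f Ω) (hfpos : ∀ x ∈ Ω, 0 < f x)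
    (h : IsMongeSolution Ω f u) : IsSSolution Ω f u := by
  have hc := h.1.continuousOn
  refine ⟨hc, ⟨hc.upperSemicontinuousOn, fun ψ₁ h₁ ψ₂ _ x hx hmax => ?_⟩,
    ⟨hc.lowerSemicontinuousOn, fun ψ₁ _ ψ₂ _ x hx hmin => ?_⟩⟩
  · rw [← h₁.2.1 x hx]
    refine (subSlope_le_add (a := u) (b := ψ₂) ?_).trans (add_le_add
      ((h.hasLipschitzBound hX hΩ hf hfpos).localSlope_le hx) (localSlope_le_slopeEnvelope _ _))
    filter_upwards [hmax] with y hy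
    have h1 := neg_le_abs (u y - u x)
    have h2 := le_abs_self (ψ₂ y - ψ₂ x)
    linarith
  · rw [← h.2 x hx]
    refine (subSlope_le_add (a := ψ₁) (b := ψ₂) ?_).trans
      (add_le_add le_rfl (localSlope_le_slopeEnvelope _ _))
    filter_upwards [hmin] with y hy
    have h1 := neg_le_abs (ψ₁ y - ψ₁ x)
    have h2 := neg_le_abs (ψ₂ y - ψ₂ x)
    linarith

/-! ### Curve-based solutions are Monge solutions -/

/-- A continuous function on the line whose derivative is at most `M` in absolute value in the
sense of tests from above grows at rate at most `M`. -/
lemma sub_le_of_forall_isLocalMax {g : ℝ → ℝ} (hg : Continuous g) {M : ℝ}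
    (h : ∀ t, ∀ φ : ℝ → ℝ, ContDiff ℝ 1 φ → IsLocalMax (fun s => g s - φ s) t → |deriv φ t| ≤ M)
    {a b : ℝ} (hab : a < b) : g b - g a ≤ M * (b - a) := by
  by_contra! hlt
  have hba : 0 < b - a := sub_pos.2 hab
  obtain ⟨k, hMk, hk⟩ := exists_between ((lt_div_iff₀ hba).2 hlt)
  rw [lt_div_iff₀ hba] at hk
  set δ := (g b - g a - k * (b - a)) / 2 with hδ
  have hδ0 : 0 < δ := by rw [hδ]; linarith
  set K := |g (b + 1) - g b - k| / δ + 1 with hK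
  have hK0 : 0 < K := by positivity
  have hKδ : δ * K = |g (b + 1) - g b - k| + δ := by rw [hK]; field_simp
  -- the exponential is negligible up to `b` and prevents a maximum at `b + 1`
  set φ : ℝ → ℝ := fun t => k * t + δ * Real.exp (K * (t - b)) with hφ
  have hφC : ContDiff ℝ 1 φ := by fun_prop
  have hφd : ∀ t, k ≤ deriv φ t := fun t => by
    have h1 : HasDerivAt φ (k * 1 + δ * (Real.exp (K * (t - b)) * (K * 1))) t :=
      ((hasDerivAt_id t).const_mul k).add
        ((((hasDerivAt_id t).sub_const b).const_mul K).exp.const_mul δ)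
    rw [h1.deriv]
    have : 0 ≤ δ * (Real.exp (K * (t - b)) * (K * 1)) := by positivity
    linarith
  obtain ⟨t, ht, hmax⟩ := (isCompact_Icc (a := a) (b := b + 1)).exists_isMaxOn
    ⟨a, left_mem_Icc.2 (by linarith)⟩ (f := fun s => g s - φ s)
    (hg.sub hφC.continuous).continuousOn
  have hb : g b - φ b ≤ g t - φ t := hmax ⟨hab.le, by linarith⟩
  have hφb : φ b = k * b + δ := by simp [hφ]
  have hta : t ≠ a := by
    rintro rfl
    have : 0 < δ * Real.exp (K * (t - b)) := by positivity
    have e : φ t = k * t + δ * Real.exp (K * (t - b)) := rfl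
    rw [hφb, e] at hb
    linarith
  have htb : t ≠ b + 1 := by
    rintro rfl
    have h1 : φ (b + 1) = k * (b + 1) + δ * Real.exp K := by simp [hφ]
    have h2 : δ * (K + 1) ≤ δ * Real.exp K :=
      mul_le_mul_of_nonneg_left (Real.add_one_le_exp K) hδ0.le
    have h3 := le_abs_self (g (b + 1) - g b - k)
    rw [hφb, h1] at hb
    linarith
  have hloc : IsLocalMax (fun s => g s - φ s) t := by
    filter_upwards [Icc_mem_nhds (lt_of_le_of_ne ht.1 (Ne.symm hta)) (lt_of_le_of_ne ht.2 htb)]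
      with s hs using hmax hs
  have := h t φ hφC hloc
  linarith [le_abs_self (deriv φ t), hφd t]

lemma IsCSubsolution.hasLipschitzBound (hX : IsGeodesicSpace X) {Ω : Set X} (hΩ : IsOpen Ω)
    {f u : X → ℝ} (hf : ContinuousOn f Ω) (hu : ContinuousOn u Ω) (h : IsCSubsolution Ω f u) :
    HasLipschitzBound Ω f u := by
  intro x hx M hM
  obtain ⟨ρ, hρ, hsub, hlt⟩ := exists_ball_subset_lt hΩ hf hx hM
  have key : ∀ y ∈ Metric.ball x (ρ / 3), ∀ z ∈ Metric.ball x (ρ / 3),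
      u z - u y ≤ M * dist y z := by
    intro y hy z hz
    rcases eq_or_ne y z with rfl | hne
    · simp
    obtain ⟨σ, h0, h1, hσ, hmem⟩ := hX.exists_geodesic_in_ball hy hz
    have e : 3 * (ρ / 3) = ρ := by ring
    rw [e] at hmem
    obtain ⟨γ, hγ, hγσ, htrace⟩ :=
      (hasUnitSpeedOn_of_dist_eq hσ).exists_extension (dist_pos.2 hne)
    have hγρ : ∀ t, γ t ∈ Metric.ball x ρ := fun t => by
      obtain ⟨s, hs, e⟩ := htrace t; rw [e]; exact hmem s hs
    have hγc : Continuous γ := continuousOn_univ.1 hγ.continuousOn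
    have hc : Continuous fun t => u (γ t) := hu.comp_continuous hγc fun t => hsub (hγρ t)
    have := sub_le_of_forall_isLocalMax hc (M := M) (a := 0) (b := dist y z) (fun t φ hφ hmax => ?_)
      (dist_pos.2 hne)
    · rw [hγσ 0 (by simp), hγσ _ (by simp), abs_zero, abs_of_nonneg dist_nonneg, h0, h1] at this
      simpa using this
    -- translate the curve and the test function so that the contact point is at time `0`
    have hmax' : IsLocalMax (fun s => u (γ (s + t)) - φ (s + t)) 0 := by
      have : Tendsto (fun s : ℝ => s + t) (𝓝 0) (𝓝 t) := by
        simpa using (continuous_add_const t).tendsto 0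
      filter_upwards [this.eventually hmax] with s hs
      simpa using hs
    have h2 := h.2 (γ t) (hsub (hγρ t)) (fun s => γ (s + t))
      ⟨by simpa using hγ.comp_add t, fun s => hsub (hγρ _), by simp⟩ (fun s => φ (s + t))
      (by fun_prop) hmax'
    rw [deriv_comp_add_const, zero_add] at h2
    exact h2.trans (hlt _ (hγρ t)).le
  refine ⟨ρ / 3, by positivity, fun y hy z hz => abs_le.2 ⟨?_, ?_⟩⟩
  · have := key y hy z hz; linarith
  · have := key z hz y hy; rw [dist_comm]; linarith

/-- A lower semicontinuous function with `|w'| ≥ m` in the sense of tests from below descends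
from `0` at any smaller rate in at least one direction. -/
lemma descent_of_forall_isLocalMin {w : ℝ → ℝ} {h m m' : ℝ} (hh : 0 < h)
    (hw : LowerSemicontinuousOn w (Icc (-h) h))
    (H : ∀ φ : ℝ → ℝ, ContDiff ℝ 1 φ → ∀ t ∈ Ioo (-h) h,
      IsLocalMin (fun s => w s - φ s) t → m ≤ |deriv φ t|) (hm' : 0 < m') (hmm' : m' < m) :
    ∃ t, |t| = h ∧ w t + m' * h ≤ w 0 := by
  by_contra! hcon
  have h1 := hcon h (abs_of_pos hh)
  have h2 := hcon (-h) (by rw [abs_neg, abs_of_pos hh])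
  obtain ⟨δ, hδ, hδm⟩ : ∃ δ > 0, δ < min (w h + m' * h - w 0) (w (-h) + m' * h - w 0) / m' :=
    exists_between (div_pos (lt_min (by linarith) (by linarith)) hm')
  rw [lt_div_iff₀ hm', lt_min_iff] at hδm
  -- a smooth concave function of slope below `m'`, close to `-m' |t|`
  set φ : ℝ → ℝ := fun t => -m' * √(t ^ 2 + δ ^ 2) with hφ
  have hφd : ∀ t, HasDerivAt φ (-m' * (t / √(t ^ 2 + δ ^ 2))) t := fun t =>
    (hasDerivAt_sqrt_sq_add_sq hδ t).const_mul _
  have hne : ∀ s : ℝ, √(s ^ 2 + δ ^ 2) ≠ 0 := fun s => by positivity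
  have hφC : ContDiff ℝ 1 φ := contDiff_one_iff_deriv.2
    ⟨fun s => (hφd s).differentiableAt, by
      rw [funext fun s => (hφd s).deriv]
      fun_prop (disch := exact hne _)⟩
  have hlsc : LowerSemicontinuousOn (fun s => w s + -φ s) (Icc (-h) h) :=
    hw.add hφC.continuous.neg.continuousOn.lowerSemicontinuousOn
  obtain ⟨t, ht, hmin⟩ := hlsc.exists_isMinOn ⟨0, by constructor <;> linarith⟩ isCompact_Icc
  have h0 : w t + -φ t ≤ w 0 + m' * δ := by
    have : w t + -φ t ≤ w 0 + -φ 0 := hmin (⟨by linarith, hh.le⟩ : (0 : ℝ) ∈ Icc (-h) h)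
    simpa [hφ, Real.sqrt_sq hδ.le] using this
  have hend : ∀ s, |s| = h → m' * h ≤ -φ s := fun s hs => by
    have h3 : h ≤ √(s ^ 2 + δ ^ 2) := Real.le_sqrt_of_sq_le (by rw [← sq_abs s, hs]; nlinarith)
    simp only [hφ]; nlinarith
  have hth : t ≠ h := by
    rintro rfl
    linarith [hend t (abs_of_pos hh)]
  have hth' : t ≠ -h := by
    rintro rfl
    linarith [hend (-h) (by rw [abs_neg, abs_of_pos hh])]
  have htI : t ∈ Ioo (-h) h := ⟨lt_of_le_of_ne ht.1 (Ne.symm hth'), lt_of_le_of_ne ht.2 hth⟩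
  have hloc : IsLocalMin (fun s => w s - φ s) t := by
    filter_upwards [Icc_mem_nhds htI.1 htI.2] with s hs
    have : w t + -φ t ≤ w s + -φ s := hmin hs
    linarith
  have h3 := H φ hφC t htI hloc
  rw [(hφd t).deriv, abs_mul, abs_neg, abs_of_pos hm', abs_div, abs_of_nonneg (Real.sqrt_nonneg _)]
    at h3
  have h4 : |t| / √(t ^ 2 + δ ^ 2) ≤ 1 := by
    rw [div_le_one (by positivity)]
    exact Real.le_sqrt_of_sq_le (by rw [sq_abs]; nlinarith)
  nlinarith

lemma dist_le_abs_of_mem_admissibleCurves {S : Set X} {x : X} {γ : ℝ → X}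
    (hγ : γ ∈ AdmissibleCurves S x) (t : ℝ) : dist x (γ t) ≤ |t| := by
  have := hγ.1.dist_le (mem_univ 0) (mem_univ t)
  rwa [hγ.2.2, zero_sub, abs_neg] at this

lemma Ioo_subset_lifeInterval {Y : Type*} {S : Set Y} {γ : ℝ → Y} {r : ℝ}
    (h : ∀ t, |t| < r → γ t ∈ S) :
    Ioo (-r) r ⊆ lifeInterval S γ := by
  intro t ht
  have hle : entranceTime S γ ≤ ((-r : ℝ) : EReal) := by
    refine sSup_le ?_
    rintro _ ⟨s, ⟨hs, hsS⟩, rfl⟩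
    by_contra! hlt
    rw [EReal.coe_lt_coe_iff] at hlt
    exact hsS (h s (by rw [abs_of_nonpos hs]; linarith))
  have hge : (r : EReal) ≤ exitTime S γ := by
    refine le_sInf ?_
    rintro _ ⟨s, ⟨hs, hsS⟩, rfl⟩
    by_contra! hlt
    rw [EReal.coe_lt_coe_iff] at hlt
    exact hsS (h s (by rwa [abs_of_nonneg hs]))
  exact ⟨hle.trans_lt (EReal.coe_lt_coe_iff.2 ht.1), (EReal.coe_lt_coe_iff.2 ht.2).trans_le hge⟩

/-- The existence of approximations for every `ε`, up to the exit from a fixed neighbourhood of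
`x`, forces `|∇⁻u|(x) ≥ f(x)`. -/
lemma le_subSlope_of_forall_isApproximation {Ω S : Set X} (hΩ : IsOpen Ω) {f u : X → ℝ}
    (hf : ContinuousOn f Ω) {x : X} (hx : x ∈ Ω) (hS : S ∈ 𝓝 x)
    (h : ∀ ε > 0, ∃ γ ∈ AdmissibleCurves univ x, ∃ w, IsApproximation S f u ε x γ w) :
    ENNReal.ofReal (f x) ≤ subSlope u x := by
  refine ofReal_le_of_forall_lt fun k hk hkf => le_subSlope_of_forall_exists hk fun δ hδ => ?_
  obtain ⟨k', hkk', hk'⟩ := exists_between hkf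
  obtain ⟨m, hkm, hmk'⟩ := exists_between hkk'
  obtain ⟨ρ, hρ, -, hlt⟩ := exists_ball_subset_lt hΩ (f := fun y => -f y) hf.neg hx
    (neg_lt_neg hk')
  obtain ⟨r, hr, hrS⟩ := Metric.mem_nhds_iff.1 hS
  obtain ⟨s, hs, hs'⟩ := exists_between (lt_min hδ (lt_min hρ hr))
  obtain ⟨hsδ, hsρ, hsr⟩ : s < δ ∧ s < ρ ∧ s < r := by simpa using hs'
  obtain ⟨ε, hε, hε'⟩ := exists_between (lt_min (mul_pos (sub_pos.2 hkm) hs) (sub_pos.2 hmk'))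
  obtain ⟨hε1, hε2⟩ : ε < (m - k) * s ∧ ε < k' - m := by simpa using hε'
  obtain ⟨γ, hγ, w, hw, hw0, hwu, hwφ⟩ := h ε hε
  have hdist := dist_le_abs_of_mem_admissibleCurves hγ
  have hlife := Ioo_subset_lifeInterval (S := S) (γ := γ) (r := r) fun t ht =>
    hrS (Metric.mem_ball'.2 ((hdist t).trans_lt ht))
  have hIcc : Icc (-s) s ⊆ Ioo (-r) r := Icc_subset_Ioo (by linarith) hsr
  obtain ⟨t, ht, hwt⟩ := descent_of_forall_isLocalMin (m := k' - ε) (m' := m) hs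
    (hw.mono (hIcc.trans hlife)) (fun φ hφ t ht hloc => by
      have h1 := hwφ φ hφ t (hlife (hIcc (Ioo_subset_Icc_self ht))) hloc
      have h2 := hlt (γ t) (Metric.mem_ball'.2 ((hdist t).trans_lt ((abs_lt.2 ht).trans hsρ)))
      linarith) (hk.trans hkm) (by linarith)
  refine ⟨γ t, s, hs, hsδ, (hdist t).trans ht.le, ?_⟩
  have := hwu t (hlife (hIcc (abs_le.1 ht.le)))
  linarith

lemma IsCSubsolution.isMongeSolution (hX : IsGeodesicSpace X) {Ω : Set X} (hΩ : IsOpen Ω)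
    {f u : X → ℝ} (hf : ContinuousOn f Ω) (hu : ContinuousOn u Ω) (h : IsCSubsolution Ω f u)
    (h' : ∀ x ∈ Ω, ENNReal.ofReal (f x) ≤ subSlope u x) : IsMongeSolution Ω f u :=
  have hL := h.hasLipschitzBound hX hΩ hf hu
  ⟨hL.locallyLipschitzOn, fun x hx =>
    le_antisymm ((subSlope_le_localSlope u x).trans (hL.localSlope_le hx)) (h' x hx)⟩

lemma IsCSolution.isMongeSolution (hX : IsGeodesicSpace X) {Ω : Set X} (hΩ : IsOpen Ω)
    {f u : X → ℝ} (hf : ContinuousOn f Ω) (h : IsCSolution Ω f u) : IsMongeSolution Ω f u :=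
  h.2.1.isMongeSolution hX hΩ hf h.1 fun x hx =>
    le_subSlope_of_forall_isApproximation hΩ hf hx (hΩ.mem_nhds hx) fun ε hε => by
      obtain ⟨γ, hγ, w, -, -, hw⟩ := h.2.2.2 ε hε x hx
      exact ⟨γ, hγ, w, hw⟩

lemma IsLocalCSolution.isMongeSolution (hX : IsGeodesicSpace X) {Ω : Set X} (hΩ : IsOpen Ω)
    {f u : X → ℝ} (hf : ContinuousOn f Ω) (h : IsLocalCSolution Ω f u) : IsMongeSolution Ω f u :=
  h.2.1.isMongeSolution hX hΩ hf h.1 fun x hx => by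
    obtain ⟨r, hr, -, H⟩ := h.2.2.2 x hx
    exact le_subSlope_of_forall_isApproximation hΩ hf hx (Metric.ball_mem_nhds x hr) H

/-! ### Monge solutions are curve-based solutions -/

lemma HasLipschitzBound.isCSubsolution {Ω : Set X} {f u : X → ℝ} (hfpos : ∀ x ∈ Ω, 0 < f x)
    (hu : ContinuousOn u Ω) (h : HasLipschitzBound Ω f u) : IsCSubsolution Ω f u := by
  refine ⟨hu.upperSemicontinuousOn, fun x hx γ hγ φ hφ hmax => ?_⟩
  refine le_of_forall_gt_imp_ge_of_dense fun M hM => ?_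
  have hM0 : 0 < M := (hfpos x hx).trans hM
  obtain ⟨ρ, hρ, H⟩ := h x hx M hM
  have hd : HasDerivAt φ (deriv φ 0) 0 :=
    (hφ.differentiable one_ne_zero).differentiableAt.hasDerivAt
  have h1 : ∀ᶠ t in 𝓝 (0 : ℝ), φ 0 - φ t ≤ M * |t| := by
    filter_upwards [hmax, Metric.ball_mem_nhds 0 hρ] with t ht htρ
    have hdt := dist_le_abs_of_mem_admissibleCurves hγ t
    have hγt : γ t ∈ Metric.ball x ρ := Metric.mem_ball'.2 (hdt.trans_lt (by simpa using htρ))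
    have h2 := (abs_le.1 (H x (Metric.mem_ball_self hρ) (γ t) hγt)).2
    have h3 : M * dist x (γ t) ≤ M * |t| := mul_le_mul_of_nonneg_left hdt hM0.le
    simp only [hγ.2.2] at ht
    linarith
  refine abs_le.2 ⟨ge_of_tendsto hd.tendsto_slope_zero_right ?_,
    le_of_tendsto hd.tendsto_slope_zero_left ?_⟩
  · filter_upwards [nhdsWithin_le_nhds h1, self_mem_nhdsWithin] with t ht ht0
    have ht0 : 0 < t := ht0
    rw [abs_of_pos ht0] at ht
    rw [zero_add, smul_eq_mul, inv_mul_eq_div, le_div_iff₀ ht0]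
    linarith
  · filter_upwards [nhdsWithin_le_nhds h1, self_mem_nhdsWithin] with t ht ht0
    have ht0 : t < 0 := ht0
    rw [abs_of_neg ht0] at ht
    rw [zero_add, smul_eq_mul, inv_mul_eq_div, div_le_iff_of_neg ht0]
    linarith

/-- A unit-speed curve from `z` leaves `Ω` at a finite time `T`, and before `T` the function `u`
along it stays below the profile `u z - ∫ (f ∘ γ - ε')` up to the error `ε`. The tolerances `ε` for
the height and `ε'` for the rate are separate: `ε` determines the width of the boundary region, and
`ε'` is bounded by the minimum of `f` outside that region. -/
def HasDescentCurve (Ω : Set X) (f u : X → ℝ) (ε ε' : ℝ) (z : X) : Prop :=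
  ∃ T > 0, ∃ γ : ℝ → X, HasUnitSpeedOn γ (Icc 0 T) ∧ γ 0 = z ∧ (∀ t ∈ Ico 0 T, γ t ∈ Ω) ∧
    γ T ∉ Ω ∧ ∀ t ∈ Ico 0 T, u (γ t) + ∫ s in (0)..t, (f (γ s) - ε') ≤ u z + ε

lemma integral_le_mul_of_continuousOn {g : ℝ → ℝ} {a b C : ℝ} (hab : a ≤ b)
    (hg : ContinuousOn g (Icc a b)) (hC : ∀ s ∈ Icc a b, g s ≤ C) :
    ∫ s in a..b, g s ≤ C * (b - a) := by
  have := intervalIntegral.integral_mono_on (μ := MeasureTheory.volume) hab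
    (hg.intervalIntegrable_of_Icc hab) (intervalIntegrable_const (c := C)) hC
  rwa [intervalIntegral.integral_const, smul_eq_mul, mul_comm] at this

/-- Prepending a geodesic segment along which `u` descends fast enough. -/
lemma HasDescentCurve.prepend {Ω : Set X} {f u : X → ℝ} {ε ε' δ : ℝ} {z : X} {σ : ℝ → X}
    (hf : ContinuousOn f Ω) (hδ : 0 < δ) (h : HasDescentCurve Ω f u ε ε' (σ δ))
    (hσ : HasUnitSpeedOn σ (Icc 0 δ)) (hσ0 : σ 0 = z) (hmem : ∀ t ∈ Icc 0 δ, σ t ∈ Ω)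
    (hbound : ∀ t ∈ Icc 0 δ, u (σ t) + ∫ s in (0)..t, (f (σ s) - ε') ≤ u z + ε)
    (hend : u (σ δ) + ∫ s in (0)..δ, (f (σ s) - ε') ≤ u z) :
    HasDescentCurve Ω f u ε ε' z := by
  obtain ⟨T, hT, γ, hγ, hγ0, hγΩ, hγT, hγu⟩ := h
  set γ' : ℝ → X := fun t => if t ≤ δ then σ t else γ (t - δ) with hγ'
  have e1 : ∀ t ≤ δ, γ' t = σ t := fun t ht => if_pos ht
  have e2 : ∀ t, δ ≤ t → γ' t = γ (t - δ) := fun t ht => by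
    rcases ht.eq_or_lt with rfl | ht
    · rw [e1 _ le_rfl, sub_self, hγ0]
    · exact if_neg ht.not_ge
  have hu1 : HasUnitSpeedOn γ' (Icc 0 δ) := hσ.congr fun t ht => e1 t ht.2
  have hu2 : HasUnitSpeedOn γ' (Icc δ (δ + T)) := by
    have := hγ.comp_add (-δ)
    rw [preimage_add_const_Icc] at this
    have h3 := this.congr (γ' := γ') fun t ht => by
      simpa [sub_eq_add_neg] using e2 t (by simpa using ht.1)
    rwa [sub_neg_eq_add, sub_neg_eq_add, zero_add, add_comm T δ] at h3
  have hu := hu1.Icc_Icc hu2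
  have hΩ : ∀ t ∈ Ico 0 (δ + T), γ' t ∈ Ω := fun t ht => by
    rcases le_total t δ with h | h
    · rw [e1 t h]; exact hmem t ⟨ht.1, h⟩
    · rw [e2 t h]; exact hγΩ _ ⟨by linarith, by linarith [ht.2]⟩
  refine ⟨δ + T, by positivity, γ', hu, by rw [e1 0 hδ.le, hσ0], hΩ, ?_, fun t ht => ?_⟩
  · rw [e2 _ (by linarith), add_sub_cancel_left]; exact hγT
  have hint : ∀ a ∈ Icc 0 t, ∀ b ∈ Icc 0 t,
      IntervalIntegrable (fun s => f (γ' s) - ε') MeasureTheory.volume a b := fun a ha b hb => by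
    refine ContinuousOn.intervalIntegrable (ContinuousOn.sub (hf.comp (hu.continuousOn.mono ?_) ?_)
      continuousOn_const)
    · exact (uIcc_subset_Icc ha hb).trans (Icc_subset_Icc_right ht.2.le)
    · intro s hs
      have := uIcc_subset_Icc ha hb hs
      exact hΩ s ⟨this.1, this.2.trans_lt ht.2⟩
  have i1 : ∀ t, 0 ≤ t → t ≤ δ →
      ∫ s in (0)..t, (f (γ' s) - ε') = ∫ s in (0)..t, (f (σ s) - ε') := fun t ht0 ht => by
    refine intervalIntegral.integral_congr fun s hs => ?_
    rw [uIcc_of_le ht0] at hs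
    simp only [e1 s (hs.2.trans ht)]
  rcases le_total t δ with htδ | htδ
  · rw [e1 t htδ, i1 t ht.1 htδ]
    exact hbound t ⟨ht.1, htδ⟩
  · have i2 : ∫ s in δ..t, (f (γ' s) - ε') = ∫ s in (0)..(t - δ), (f (γ s) - ε') := by
      have := intervalIntegral.integral_comp_sub_right (fun s => f (γ s) - ε') δ (a := δ) (b := t)
      rw [sub_self] at this
      rw [← this]
      refine intervalIntegral.integral_congr fun s hs => ?_
      rw [uIcc_of_le htδ] at hs
      simp only [e2 s hs.1]
    have i3 := intervalIntegral.integral_add_adjacent_intervals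
      (hint 0 ⟨le_rfl, ht.1⟩ δ ⟨hδ.le, htδ⟩) (hint δ ⟨hδ.le, htδ⟩ t ⟨ht.1, le_rfl⟩)
    rw [← i3, i1 δ hδ.le le_rfl, i2, e2 t htδ]
    have := hγu (t - δ) ⟨by linarith, by linarith [ht.2]⟩
    linarith

/-- Along a geodesic in `Ω` both `u` and the integral of `f` grow at most linearly. -/
lemma add_integral_le_of_geodesic {Ω : Set X} {f u : X → ℝ} (hf : ContinuousOn f Ω)
    (hfpos : ∀ x ∈ Ω, 0 < f x) {M : ℝ} (hM : ∀ x ∈ Ω, f x ≤ M) (hu : IsMongeSolution Ω f u)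
    {ε' : ℝ} (hε' : 0 ≤ ε') {σ : ℝ → X} {t : ℝ} (ht : 0 ≤ t)
    (hσ : ∀ s ∈ Icc 0 t, ∀ s' ∈ Icc 0 t, dist (σ s) (σ s') = |s - s'|)
    (hmem : ∀ s ∈ Icc 0 t, σ s ∈ Ω) :
    u (σ t) + ∫ s in (0)..t, (f (σ s) - ε') ≤ u (σ 0) + 2 * M * t := by
  have h0 : (0 : ℝ) ∈ Icc 0 t := ⟨le_rfl, ht⟩
  have hM0 : 0 ≤ M := (hfpos _ (hmem 0 h0)).le.trans (hM _ (hmem 0 h0))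
  have h1 := abs_sub_le_of_subSlope_le hu.1.continuousOn ht hM0
    (fun s hs s' hs' => (hσ s hs s' hs').le) hmem
    fun s hs => (hu.2 _ (hmem s hs)).trans_le (ENNReal.ofReal_le_ofReal (hM _ (hmem s hs)))
  have h2 := integral_le_mul_of_continuousOn (g := fun s => f (σ s) - ε') (C := M) ht
    ((hf.comp (hasUnitSpeedOn_of_dist_eq hσ).continuousOn hmem).sub continuousOn_const)
    fun s hs => by have := hM _ (hmem s hs); linarith
  have h3 := (abs_le.1 h1).2
  linarith

/-- Near the boundary, the geodesic to a nearest point of the complement is a descent curve: it is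
too short for `u` or the profile to change by more than `ε / 2`. -/
lemma IsMongeSolution.hasDescentCurve_of_mem_thickening [ProperSpace X] (hX : IsGeodesicSpace X)
    {Ω : Set X} (hΩ : IsOpen Ω) {f u : X → ℝ} (hf : ContinuousOn f Ω)
    (hfpos : ∀ x ∈ Ω, 0 < f x) {M : ℝ} (hM0 : 0 < M) (hM : ∀ x ∈ Ω, f x ≤ M)
    (hu : IsMongeSolution Ω f u) {ε ε' : ℝ} (hε' : 0 ≤ ε') {z : X} (hz : z ∈ Ω)
    (hzη : z ∈ Metric.thickening (ε / (2 * M)) Ωᶜ) : HasDescentCurve Ω f u ε ε' z := by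
  obtain ⟨q, hq, hzq⟩ := Metric.mem_thickening_iff.1 hzη
  obtain ⟨p, hp, hzp⟩ := hΩ.isClosed_compl.exists_infDist_eq_dist ⟨q, hq⟩ z
  have hpos : 0 < dist z p := dist_pos.2 fun h => hp (h ▸ hz)
  have hlt : dist z p < ε / (2 * M) := by
    rw [← hzp]; exact (Metric.infDist_le_dist_of_mem hq).trans_lt hzq
  obtain ⟨σ, hσ0, hσ1, hσ⟩ := hX.exists_geodesic z p
  have hmem : ∀ t ∈ Ico 0 (dist z p), σ t ∈ Ω := fun t ht => by
    by_contra hcon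
    have h1 := hσ 0 (left_mem_Icc.2 dist_nonneg) t (Ico_subset_Icc_self ht)
    rw [hσ0, zero_sub, abs_neg, abs_of_nonneg ht.1] at h1
    have h2 := Metric.infDist_le_dist_of_mem (x := z) (s := Ωᶜ) hcon
    linarith [ht.2]
  refine ⟨dist z p, hpos, σ, hasUnitSpeedOn_of_dist_eq hσ, hσ0, hmem, by rwa [hσ1],
    fun t ht => ?_⟩
  have hI : Icc 0 t ⊆ Icc 0 (dist z p) := Icc_subset_Icc_right ht.2.le
  have := add_integral_le_of_geodesic hf hfpos hM hu hε' ht.1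
    (fun s hs s' hs' => hσ s (hI hs) s' (hI hs')) fun s hs => hmem s ⟨hs.1, hs.2.trans_lt ht.2⟩
  rw [lt_div_iff₀ (by positivity)] at hlt
  have h2 : 2 * M * t ≤ 2 * M * dist z p := mul_le_mul_of_nonneg_left ht.2.le (by positivity)
  rw [hσ0] at this
  linarith

/-- Every point has a descent curve. Away from the boundary, steps of a fixed length `δ` are
possible, each of which lowers `u` by a fixed amount; as `u` is bounded below there, the boundary
region is reached after finitely many steps. -/
lemma IsMongeSolution.exists_hasDescentCurve [ProperSpace X] (hX : IsGeodesicSpace X) {Ω : Set X}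
    (hΩ : IsOpen Ω) (hΩb : Bornology.IsBounded Ω) {f u : X → ℝ} (hf : ContinuousOn f Ω)
    (hfpos : ∀ x ∈ Ω, 0 < f x) {M : ℝ} (hM : ∀ x ∈ Ω, f x ≤ M)
    (hu : IsMongeSolution Ω f u) {ε : ℝ} (hε : 0 < ε) {x : X} (hx : x ∈ Ω) :
    ∃ ε' > 0, ε' ≤ ε ∧ HasDescentCurve Ω f u ε ε' x := by
  have hM0 : 0 < M := (hfpos x hx).trans_le (hM x hx)
  have huc : ContinuousOn u Ω := hu.1.continuousOn
  set η := ε / (2 * M) with hη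
  have hη0 : 0 < η := by positivity
  have hMη : 2 * M * η = ε := by rw [hη]; field_simp
  set K := (Metric.thickening (η / 2) Ωᶜ)ᶜ with hK
  have hKΩ : K ⊆ Ω := by
    rw [hK, compl_subset_comm]; exact Metric.self_subset_thickening (by positivity) _
  have hKc : IsCompact K := Metric.isCompact_of_isClosed_isBounded
    Metric.isOpen_thickening.isClosed_compl (hΩb.subset hKΩ)
  obtain ⟨c, hc, hcf⟩ := hKc.exists_forall_le' (hf.mono hKΩ) fun b hb => hfpos b (hKΩ hb)
  obtain ⟨L, hL⟩ := (hKc.image_of_continuousOn (huc.mono hKΩ)).bddBelow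
  -- with `ε' ≤ c` every step descends at rate at least `f - ε' / 2 ≥ c / 2`
  set ε' := min ε c with hε'def
  have hε' : 0 < ε' := lt_min hε hc
  have hε'c : ε' ≤ c := min_le_right _ _
  obtain ⟨δ₀, hδ₀, Hδ₀⟩ := Metric.uniformContinuousOn_iff.1
    (hKc.uniformContinuousOn_of_continuous (hf.mono hKΩ)) (ε' / 2) (by positivity)
  obtain ⟨δ, hδ, hδlt⟩ := exists_between (lt_min hδ₀ (half_pos hη0))
  obtain ⟨hδδ₀, hδη⟩ := lt_min_iff.1 hδlt
  refine ⟨ε', hε', min_le_left _ _, ?_⟩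
  have key : ∀ n : ℕ, ∀ z ∈ Ω, u z ≤ L - 1 + n * (c / 2 * δ) → HasDescentCurve Ω f u ε ε' z := by
    intro n
    induction n with
    | zero =>
      intro z hz hzL
      refine hu.hasDescentCurve_of_mem_thickening hX hΩ hf hfpos hM0 hM hε'.le hz ?_
      by_contra hcon
      have hzK : z ∈ K := fun h => hcon (Metric.thickening_mono (by linarith) _ h)
      have := hL (mem_image_of_mem u hzK)
      simp at hzL
      linarith
    | succ n ih =>
      intro z hz hzL
      by_cases hcon : z ∈ Metric.thickening η Ωᶜ
      · exact hu.hasDescentCurve_of_mem_thickening hX hΩ hf hfpos hM0 hM hε'.le hz hcon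
      have hball : Metric.closedBall z δ ⊆ K := fun y hy hyK => by
        obtain ⟨p, hp, hyp⟩ := Metric.mem_thickening_iff.1 hyK
        refine hcon (Metric.mem_thickening_iff.2 ⟨p, hp, ?_⟩)
        have := dist_triangle z y p
        rw [Metric.mem_closedBall'] at hy
        linarith
      have hzK : z ∈ K := hball (Metric.mem_closedBall_self hδ.le)
      have hosc : ∀ y ∈ Metric.closedBall z δ, |f y - f z| < ε' / 2 := fun y hy =>
        Hδ₀ y (hball hy) z hzK ((Metric.mem_closedBall.1 hy).trans_lt hδδ₀)
      have hcz := hcf z hzK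
      obtain ⟨y, hy, hyu⟩ := hu.exists_descent huc (k := f z - ε' / 2) hδ (by linarith)
        (hball.trans hKΩ) fun y hy => by
          have := (abs_lt.1 (hosc y (Metric.ball_subset_closedBall hy))).1
          linarith
      obtain ⟨σ, hσ0, hσ1, hσ⟩ := hX.exists_geodesic z y
      rw [hy] at hσ1 hσ
      have hσb : ∀ t ∈ Icc 0 δ, σ t ∈ Metric.closedBall z δ := fun t ht => by
        have := hσ 0 (left_mem_Icc.2 hδ.le) t ht
        rw [hσ0, zero_sub, abs_neg, abs_of_nonneg ht.1] at this
        rw [Metric.mem_closedBall', this]; exact ht.2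
      have hσΩ : ∀ t ∈ Icc 0 δ, σ t ∈ Ω := fun t ht => hKΩ (hball (hσb t ht))
      have hunit := hasUnitSpeedOn_of_dist_eq hσ
      refine HasDescentCurve.prepend hf hδ ?_ hunit hσ0 hσΩ (fun t ht => ?_) ?_
      · rw [hσ1]
        refine ih y (hσ1 ▸ hσΩ δ (right_mem_Icc.2 hδ.le)) ?_
        push_cast at hzL
        nlinarith
      · have hI : Icc 0 t ⊆ Icc 0 δ := Icc_subset_Icc_right ht.2
        have := add_integral_le_of_geodesic hf hfpos hM hu hε'.le ht.1
          (fun s hs s' hs' => hσ s (hI hs) s' (hI hs')) fun s hs => hσΩ s (hI hs)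
        rw [hσ0] at this
        have h2 : 2 * M * t ≤ 2 * M * η := mul_le_mul_of_nonneg_left (by linarith [ht.2])
          (by positivity)
        linarith
      · have := integral_le_mul_of_continuousOn (g := fun s => f (σ s) - ε') (C := f z - ε' / 2)
          hδ.le ((hf.comp hunit.continuousOn hσΩ).sub continuousOn_const) fun s hs => by
            have := (abs_lt.1 (hosc _ (hσb s hs))).2
            linarith
        rw [hσ1]
        linarith
  obtain ⟨n, hn⟩ := exists_nat_ge ((u x - (L - 1)) / (c / 2 * δ))
  rw [div_le_iff₀ (by positivity)] at hn
  exact key n x hx (by linarith)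

/-- A descent curve, run in both directions of time, together with the profile
`u x - ∫ (f ∘ γ - ε')`, is an approximation. The profile has a concave kink at time `0`, where no
test function can touch it from below. -/
lemma HasDescentCurve.exists_isApproximation {Ω : Set X} {f u : X → ℝ} (hf : ContinuousOn f Ω)
    {ε ε' : ℝ} (hε : ε' ≤ ε) {x : X} (h : HasDescentCurve Ω f u ε ε' x) :
    ∃ γ ∈ AdmissibleCurves univ x, ∃ w : ℝ → ℝ,
      ⊥ < entranceTime Ω γ ∧ exitTime Ω γ < ⊤ ∧ IsApproximation Ω f u ε x γ w := by
  obtain ⟨T, hT, γ₀, hγ₀, h0, hγΩ, hγT, hγu⟩ := h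
  obtain ⟨γ, hγ, hγe, -⟩ := hγ₀.exists_extension hT
  have hTm : ((-T : ℝ) : EReal) ≤ entranceTime Ω γ := le_sSup ⟨-T, ⟨by linarith, by
    rw [hγe _ (by rw [abs_neg, abs_of_pos hT]), abs_neg, abs_of_pos hT]; exact hγT⟩, rfl⟩
  have hTp : exitTime Ω γ ≤ (T : EReal) := sInf_le ⟨T, ⟨hT.le, by
    rw [hγe _ (by rw [abs_of_pos hT]), abs_of_pos hT]; exact hγT⟩, rfl⟩
  have hlife : lifeInterval Ω γ ⊆ Ioo (-T) T := fun t ht =>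
    ⟨EReal.coe_lt_coe_iff.1 (hTm.trans_lt ht.1), EReal.coe_lt_coe_iff.1 (ht.2.trans_le hTp)⟩
  have habs : ∀ t ∈ Ioo (-T) T, |t| ∈ Ioo (-T) T := fun t ht =>
    ⟨by linarith [abs_nonneg t], abs_lt.2 ht⟩
  have hγabs : ∀ t ∈ Ioo (-T) T, γ |t| = γ t := fun t ht => by
    have := (abs_lt.2 ht).le
    rw [hγe t this, hγe |t| (by rwa [abs_abs]), abs_abs]
  have hΩ : ∀ t ∈ Ioo (-T) T, γ t ∈ Ω := fun t ht => by
    rw [hγe t (abs_lt.2 ht).le]; exact hγΩ _ ⟨abs_nonneg t, abs_lt.2 ht⟩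
  have hγ0 : γ 0 = x := by rw [hγe 0 (by simpa using hT.le), abs_zero, h0]
  set F : ℝ → ℝ := fun s => f (γ s) - ε' with hF
  have hFc : ContinuousOn F (Ioo (-T) T) :=
    (hf.comp (hγ.continuousOn.mono (subset_univ _)) hΩ).sub continuousOn_const
  have h0I : (0 : ℝ) ∈ Ioo (-T) T := ⟨by linarith, hT⟩
  set G : ℝ → ℝ := fun t => ∫ s in (0)..t, F s with hG
  have hGd : ∀ t ∈ Ioo (-T) T, HasDerivAt G (F t) t := fun t ht => by
    refine intervalIntegral.integral_hasDerivAt_right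
      ((hFc.mono (ordConnected_Ioo.uIcc_subset h0I ht)).intervalIntegrable)
      (hFc.stronglyMeasurableAtFilter isOpen_Ioo t ht)
      (hFc.continuousAt (isOpen_Ioo.mem_nhds ht))
  have hGc : ContinuousOn G (Ioo (-T) T) := fun t ht =>
    (hGd t ht).continuousAt.continuousWithinAt
  have hG0 : G 0 = 0 := by simp [hG]
  refine ⟨γ, ⟨hγ, fun _ => mem_univ _, hγ0⟩, fun t => u x - G |t|,
    (EReal.bot_lt_coe _).trans_le hTm, hTp.trans_lt (EReal.coe_lt_top _), ?_, by simp [hG0], ?_, ?_⟩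
  · exact ContinuousOn.lowerSemicontinuousOn ((continuousOn_const.sub
      (hGc.comp continuous_abs.continuousOn habs)).mono hlife)
  · intro t ht
    have htI := hlife ht
    have h1 := hγu |t| ⟨abs_nonneg t, abs_lt.2 htI⟩
    have h2 : ∫ s in (0)..|t|, (f (γ₀ s) - ε') = G |t| := by
      refine intervalIntegral.integral_congr fun s hs => ?_
      rw [uIcc_of_le (abs_nonneg t)] at hs
      have : |s| = s := abs_of_nonneg hs.1
      simp only [hF]
      rw [hγe s (by rw [this]; exact hs.2.trans (abs_lt.2 htI).le), this]
    rw [h2, ← hγe t (abs_lt.2 htI).le] at h1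
    linarith
  · intro φ hφ t ht hmin
    have htI := hlife ht
    have hφd : ∀ s, HasDerivAt φ (deriv φ s) s := fun s =>
      (hφ.differentiable one_ne_zero).differentiableAt.hasDerivAt
    have hFt : f (γ t) - ε ≤ |F (|t|)| := by
      refine le_trans ?_ (le_abs_self _)
      simp only [hF, hγabs t htI]; linarith
    rcases lt_trichotomy t 0 with hneg | rfl | hpos
    · have h1 : HasDerivAt (fun s => u x - G (-s) - φ s) (0 - F (-t) * (-1) - deriv φ t) t :=
        ((hasDerivAt_const t (u x)).sub
          ((hGd (-t) ⟨by linarith [htI.2], by linarith [htI.1]⟩).comp t (hasDerivAt_neg t))).sub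
          (hφd t)
      have hev : (fun s => u x - G |s| - φ s) =ᶠ[𝓝 t] fun s => u x - G (-s) - φ s := by
        filter_upwards [Iio_mem_nhds hneg] with s hs
        rw [abs_of_neg hs]
      have h2 := hmin.hasDerivAt_eq_zero (h1.congr_of_eventuallyEq hev)
      rw [abs_of_neg hneg] at hFt
      have : deriv φ t = F (-t) := by linarith
      rwa [this]
    · rw [abs_zero] at hFt
      rcases le_or_gt (F 0) 0 with hF0 | hF0
      · refine le_trans ?_ (abs_nonneg _)
        simp only [hF] at hF0; linarith
      exfalso
      -- the sum of the two difference quotients at the kink has derivative `-2 F 0 < 0`, but a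
      -- touching test function would make it nonnegative
      have hd : HasDerivAt (fun s => -2 * G s - φ s - φ (-s))
          (-2 * F 0 - deriv φ 0 - deriv φ 0 * (-1)) 0 :=
        (((hGd 0 h0I).const_mul (-2)).sub (hφd 0)).sub
          (HasDerivAt.comp 0 (by simpa using hφd (-0)) (hasDerivAt_neg 0))
      have hmin' : ∀ᶠ s in 𝓝 (0 : ℝ), u x - G |-s| - φ (-s) ≥ u x - G |0| - φ 0 := by
        have : Tendsto (fun s : ℝ => -s) (𝓝 0) (𝓝 0) := by simpa using continuous_neg.tendsto (0 : ℝ)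
        exact this.eventually hmin
      have := ge_of_tendsto hd.tendsto_slope_zero_right (b := 0) (by
        filter_upwards [nhdsWithin_le_nhds hmin, nhdsWithin_le_nhds hmin', self_mem_nhdsWithin]
          with s h1 h2 hs
        have hs : 0 < s := hs
        simp only [abs_neg, abs_zero, abs_of_pos hs, hG0] at h1 h2
        rw [zero_add, smul_eq_mul]
        refine mul_nonneg (inv_nonneg.2 hs.le) ?_
        simp only [hG0, neg_zero]
        linarith)
      linarith
    · have h1 : HasDerivAt (fun s => u x - G s - φ s) (0 - F t - deriv φ t) t :=
        ((hasDerivAt_const t (u x)).sub (hGd t htI)).sub (hφd t)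
      have hev : (fun s => u x - G |s| - φ s) =ᶠ[𝓝 t] fun s => u x - G s - φ s := by
        filter_upwards [Ioi_mem_nhds hpos] with s hs
        rw [abs_of_pos hs]
      have h2 := hmin.hasDerivAt_eq_zero (h1.congr_of_eventuallyEq hev)
      rw [abs_of_pos hpos] at hFt
      have : deriv φ t = -F t := by linarith
      rwa [this, abs_neg]

lemma IsMongeSolution.isCSupersolution [ProperSpace X] (hX : IsGeodesicSpace X) {Ω : Set X}
    (hΩ : IsOpen Ω) (hΩb : Bornology.IsBounded Ω) {f u : X → ℝ} (hf : ContinuousOn f Ω)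
    (hfpos : ∀ x ∈ Ω, 0 < f x) (hfb : BddAbove (f '' Ω)) (hu : IsMongeSolution Ω f u) :
    IsCSupersolution Ω f u := by
  obtain ⟨M, hM⟩ := hfb
  refine ⟨hu.1.continuousOn.lowerSemicontinuousOn, fun ε hε x hx => ?_⟩
  obtain ⟨ε', -, hle, h⟩ := hu.exists_hasDescentCurve hX hΩ hΩb hf hfpos
    (fun y hy => hM (mem_image_of_mem f hy)) hε hx
  exact h.exists_isApproximation hf hle

lemma IsMongeSolution.mono {Ω Ω' : Set X} {f u : X → ℝ} (hu : IsMongeSolution Ω f u)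
    (h : Ω' ⊆ Ω) : IsMongeSolution Ω' f u :=
  ⟨hu.1.mono h, fun x hx => hu.2 x (h hx)⟩

lemma IsMongeSolution.isLocalCSupersolution [ProperSpace X] (hX : IsGeodesicSpace X) {Ω : Set X}
    (hΩ : IsOpen Ω) {f u : X → ℝ} (hf : ContinuousOn f Ω) (hfpos : ∀ x ∈ Ω, 0 < f x)
    (hu : IsMongeSolution Ω f u) : IsLocalCSupersolution Ω f u := by
  refine ⟨hu.1.continuousOn.lowerSemicontinuousOn, fun x hx => ?_⟩
  obtain ⟨r, hr, hsub, hlt⟩ := exists_ball_subset_lt hΩ hf hx (lt_add_one (f x))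
  refine ⟨r, hr, hsub, fun ε hε => ?_⟩
  have hb : BddAbove (f '' Metric.ball x r) :=
    ⟨f x + 1, by rintro _ ⟨y, hy, rfl⟩; exact (hlt y hy).le⟩
  obtain ⟨γ, hγ, w, -, -, hw⟩ := ((hu.mono hsub).isCSupersolution hX Metric.isOpen_ball
    Metric.isBounded_ball (hf.mono hsub) (fun y hy => hfpos y (hsub hy)) hb).2 ε hε x
    (Metric.mem_ball_self hr)
  exact ⟨γ, hγ, w, hw⟩

end Eikonal

theorem mainTheorem4 {X : Type*} [MetricSpace X] [ProperSpace X] [CompleteSpace X]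
    (hX : Eikonal.IsGeodesicSpace X)
    (Ω : Set X) (hΩ : IsOpen Ω) (hΩb : Bornology.IsBounded Ω)
    (f : X → ℝ) (hf : ContinuousOn f Ω) (hfpos : ∀ x ∈ Ω, 0 < f x)
    (u : X → ℝ) (hu : ContinuousOn u Ω) :
    [Eikonal.IsLocalCSolution Ω f u,
      Eikonal.IsSSolution Ω f u,
      Eikonal.IsMongeSolution Ω f u].TFAE ∧
    (Eikonal.IsCSolution Ω f u → Eikonal.IsMongeSolution Ω f u) ∧
    (BddAbove (f '' Ω) →
      [Eikonal.IsCSolution Ω f u,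
        Eikonal.IsSSolution Ω f u,
        Eikonal.IsMongeSolution Ω f u].TFAE) ∧
    (Eikonal.IsCSolution Ω f u ∨ Eikonal.IsLocalCSolution Ω f u ∨
        Eikonal.IsSSolution Ω f u ∨ Eikonal.IsMongeSolution Ω f u →
      LocallyLipschitzOn Ω u ∧
      ∀ x ∈ Ω, Eikonal.localSlope u x = ENNReal.ofReal (f x) ∧
        Eikonal.subSlope u x = ENNReal.ofReal (f x)) := by
  have lc_m : Eikonal.IsLocalCSolution Ω f u → Eikonal.IsMongeSolution Ω f u :=
    fun h => h.isMongeSolution hX hΩ hf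
  have c_m : Eikonal.IsCSolution Ω f u → Eikonal.IsMongeSolution Ω f u :=
    fun h => h.isMongeSolution hX hΩ hf
  have s_m : Eikonal.IsSSolution Ω f u → Eikonal.IsMongeSolution Ω f u :=
    fun h => h.isMongeSolution hX hΩ hf hfpos
  have m_s : Eikonal.IsMongeSolution Ω f u → Eikonal.IsSSolution Ω f u :=
    fun h => h.isSSolution hX hΩ hf hfpos
  have m_csub : Eikonal.IsMongeSolution Ω f u → Eikonal.IsCSubsolution Ω f u :=
    fun h => (h.hasLipschitzBound hX hΩ hf hfpos).isCSubsolution hfpos hu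
  refine ⟨?_, c_m, fun hfb => ?_, fun h => ?_⟩
  · tfae_have 1 → 3 := lc_m
    tfae_have 2 → 3 := s_m
    tfae_have 3 → 2 := m_s
    tfae_have 3 → 1 := fun h => ⟨hu, m_csub h, h.isLocalCSupersolution hX hΩ hf hfpos⟩
    tfae_finish
  · tfae_have 1 → 3 := c_m
    tfae_have 2 → 3 := s_m
    tfae_have 3 → 2 := m_s
    tfae_have 3 → 1 := fun h => ⟨hu, m_csub h, h.isCSupersolution hX hΩ hΩb hf hfpos hfb⟩
    tfae_finish
  · have hm : Eikonal.IsMongeSolution Ω f u := by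
      rcases h with h | h | h | h
      exacts [c_m h, lc_m h, s_m h, h]
    refine ⟨hm.1, fun x hx => ⟨le_antisymm
      ((hm.hasLipschitzBound hX hΩ hf hfpos).localSlope_le hx) ?_, hm.2 x hx⟩⟩
    rw [← hm.2 x hx]
    exact Eikonal.subSlope_le_localSlope u x
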